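/- \textbf{Lemma (hypercontractivity for mixtures).} Let $\pi=\sum_{k=1}^m w_k\pi_k$ be a finite mixture of probability measures on a measurable space $\Omega$, with weights $w_k>0$, $\sum_k w_k=1$. Let $(P_t)_{t\ge 0}$ be a reversible Markov semigroup on $\Omega$ with stationary distribution $\pi$ and generator $\mathscr L$ and, for each $k$, let $(P^{(k)}_t)_{t\ge0}$ be a Markov semigroup on $\Omega$ with stationary distribution $\pi_k$ and generator $\mathscr L_k$ (semigroups of Markov kernels, strongly continuous on $L^2$ of the stationary distribution). Write $\mathscr E(f,f)=-\langle f,\mathscr L f\rangle_\pi$ and $\mathscr E_k(f,f)=-\langle f,\mathscr L_k f\rangle_{\pi_k}$ for the Dirichlet forms, understood on all of $L^2$ as $[0,\infty]$-valued functionals through $\mathscr E(f,f)=\limsup_{t\downarrow0}\frac1t\langle f,f-P_tf\rangle_\pi$, and similarly for $\mathscr E_k$. Assume: \begin{enumerate} \item $\langle f,\mathscr L f\rangle_\pi\le\sum_{k=1}^m w_k\langle f,\mathscr L_k f\rangle_{\pi_k}$, that is, $\sum_{k} w_k\mathscr E_k(f,f)\le\mathscr E(f,f)$, for all $f\in L^2(\pi)$;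 \item for each $k$ there is $c_k>0$ such that $\operatorname{Ent}_{\pi_k}(f^2)\le 2c_k\,\mathscr E_k(f,f)$ for all $f\in L^2(\pi_k)$, where $\operatorname{Ent}_\mu(g)=\int g\log g\,d\mu-\int g\,d\mu\,\log\int g\,d\mu\in[0,\infty]$. \end{enumerate} Let $C^*=\max_k c_k$, $w^*=\min_k w_k$, $p>1$, and $q(t)=1+(p-1)e^{2t/C^*}$ for $t\ge0$. Then for every $f\in L^p(\pi)$ with $f>0$ $\pi$-almost everywhere, the function \[ t\longmapsto \frac{\|P_tf\|_{L^{q(t)}(\pi)}}{(w^*)^{1/q(t)}} \] is nonincreasing on $[0,\infty)$. In particular, for every $t\ge0$, $P_tf\in L^{q(t)}(\pi)$, \[ \frac{\|P_tf\|_{L^{q(t)}(\pi)}}{(w^*)^{1/q(t)}}\le\frac{\|f\|_{L^p(\pi)}}{(w^*)^{1/p}} \qquad\text{and}\qquad \|P_tf\|_{L^{q(t)}(\pi)}\le\Big(\frac1{w^*}\Big)^{\frac1p-\frac1{q(t)}}\|f\|_{L^p(\pi)} . \] -/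

import Mathlib

open MeasureTheory ProbabilityTheory Filter Topology
open scoped NNReal ENNReal

noncomputable section

namespace MixtureHC

variable {Ω : Type*} [MeasurableSpace Ω]

/-- The action `(κ f)(x) = ∫ f(y) κ(x, dy)` of a kernel on a function. -/
def act (κ : Kernel Ω Ω) (f : Ω → ℝ) (x : Ω) : ℝ := ∫ y, f y ∂(κ x)

/-- `P` is the transition semigroup of a (conservative, time-homogeneous) Markov process with
stationary law `μ`: Markov kernels with `P 0 = id` and the Chapman–Kolmogorov equation, leaving
`μ` invariant and strongly continuous on `L²(μ)`. -/
structure IsMarkovSemigroup (P : ℝ≥0 → Kernel Ω Ω) (μ : Measure Ω) : Prop where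
  markov : ∀ t, IsMarkovKernel (P t)
  zero : P 0 = Kernel.id
  add : ∀ s t, P (s + t) = P s ∘ₖ P t
  invariant : ∀ t, (P t).Invariant μ
  continuous : ∀ f : Ω → ℝ, MemLp f 2 μ →
    Tendsto (fun t => eLpNorm (fun x => act (P t) f x - f x) 2 μ) (𝓝[>] 0) (𝓝 0)

/-- A Markov semigroup with stationary law `μ` that is reversible (detailed balance). -/
structure IsReversibleMarkovSemigroup (P : ℝ≥0 → Kernel Ω Ω) (μ : Measure Ω) : Prop
    extends IsMarkovSemigroup P μ where
  reversible : ∀ t, (P t).IsReversible μ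

/-- `f` lies in the domain of the `L²(μ)`-generator `𝓛` of `P` and `𝓛 f = g`, that is,
`g = ∂ₜ (P t f)` at `t = 0`, as a limit in `L²(μ)`. -/
def HasGenerator (P : ℝ≥0 → Kernel Ω Ω) (μ : Measure Ω) (f g : Ω → ℝ) : Prop :=
  MemLp f 2 μ ∧ MemLp g 2 μ ∧
    Tendsto (fun t : ℝ≥0 => eLpNorm (fun x => (t : ℝ)⁻¹ * (act (P t) f x - f x) - g x) 2 μ)
      (𝓝[>] 0) (𝓝 0)

/-- The Dirichlet form `𝓔(f, f) = -⟨f, 𝓛 f⟩_μ = lim_{t ↓ 0} t⁻¹ ⟨f, f - P t f⟩_μ` of `P`, as a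
`[0, ∞]`-valued functional on all of `L²(μ)`: it is `∞` outside the form domain. (In the
reversible case the quotients increase as `t ↓ 0`, so that the upper limit is a limit.) -/
def dirichletForm (P : ℝ≥0 → Kernel Ω Ω) (μ : Measure Ω) (f : Ω → ℝ) : ℝ≥0∞ :=
  limsup (fun t : ℝ≥0 => ENNReal.ofReal ((t : ℝ)⁻¹ * ∫ x, f x * (f x - act (P t) f x) ∂μ))
    (𝓝[>] 0)

open scoped Classical in
/-- The entropy `Ent_μ(g) = ∫ g log g dμ - (∫ g dμ) log (∫ g dμ) ∈ [0, ∞]` of an integrable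
`g ≥ 0` under a probability measure `μ`; it is `∞` if `g log g` is not integrable. -/
def entropy (μ : Measure Ω) (g : Ω → ℝ) : ℝ≥0∞ :=
  if Integrable (fun x => g x * Real.log (g x)) μ then
    ENNReal.ofReal ((∫ x, g x * Real.log (g x) ∂μ) - (∫ x, g x ∂μ) * Real.log (∫ x, g x ∂μ))
  else ⊤

/-- The log-Sobolev inequality `Ent_μ(f²) ≤ 2 c 𝓔(f, f)`. -/
def LogSobolev (P : ℝ≥0 → Kernel Ω Ω) (μ : Measure Ω) (c : ℝ) : Prop :=
  ∀ f : Ω → ℝ, MemLp f 2 μ →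
    entropy μ (fun x => f x ^ 2) ≤ ENNReal.ofReal (2 * c) * dirichletForm P μ f

/-- The exponent `q(t) = 1 + (p - 1) e^{2t/C}`. -/
def hcExponent (p C : ℝ) (t : ℝ≥0) : ℝ := 1 + (p - 1) * Real.exp (2 * t / C)

lemma aestronglyMeasurable_act {κ : Kernel Ω Ω} [IsMarkovKernel κ] {μ : Measure Ω}
    (hκ : κ.Invariant μ) {f : Ω → ℝ} (hf : AEStronglyMeasurable f μ) :
    AEStronglyMeasurable (act κ f) μ := by
  have h0 : ∀ᵐ y ∂(μ.bind κ), f y = hf.mk f y := by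
    rw [hκ.def]; exact hf.ae_eq_mk
  have h1 : ∀ᵐ x ∂μ, ∀ᵐ y ∂(κ x), f y = hf.mk f y :=
    Measure.ae_ae_of_ae_bind κ.aemeasurable h0
  refine ⟨act κ (hf.mk f), ?_, ?_⟩
  · exact hf.stronglyMeasurable_mk.integral_kernel
  · filter_upwards [h1] with x hx using integral_congr_ae hx

/-- On the domain of the generator, `𝓔(f, f) = -⟨f, 𝓛 f⟩_μ`. -/
theorem dirichletForm_eq_of_hasGenerator {P : ℝ≥0 → Kernel Ω Ω} {μ : Measure Ω}
    (hP : IsMarkovSemigroup P μ) {f g : Ω → ℝ} (h : HasGenerator P μ f g) :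
    dirichletForm P μ f = ENNReal.ofReal (-∫ x, f x * g x ∂μ) := by
  obtain ⟨hf, hg, hlim⟩ := h
  refine Tendsto.limsup_eq (ENNReal.tendsto_ofReal ?_)
  have := hP.markov
  set r : ℝ≥0 → Ω → ℝ := fun t x => (t : ℝ)⁻¹ * (act (P t) f x - f x) - g x with hr
  have hrm : ∀ t, AEStronglyMeasurable (r t) μ := fun t =>
    (((aestronglyMeasurable_act (hP.invariant t) hf.1).sub hf.1).const_mul _).sub hg.1
  have hfin : ∀ᶠ t in 𝓝[>] (0 : ℝ≥0), MemLp (r t) 2 μ := by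
    filter_upwards [hlim.eventually (gt_mem_nhds (zero_lt_one))] with t ht
    exact ⟨hrm t, ht.trans ENNReal.one_lt_top⟩
  have key : ∀ᶠ t : ℝ≥0 in 𝓝[>] (0 : ℝ≥0),
      (t : ℝ)⁻¹ * ∫ x, f x * (f x - act (P t) f x) ∂μ
        = -(∫ x, f x * g x ∂μ) - ∫ x, f x * r t x ∂μ := by
    filter_upwards [hfin] with t ht
    have i1 : Integrable (fun x => f x * g x) μ := hf.integrable_mul hg
    have i2 : Integrable (fun x => f x * r t x) μ := hf.integrable_mul ht
    have i3 : Integrable (fun x => -(f x * g x)) μ := i1.neg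
    rw [← integral_neg, ← integral_sub i3 i2, ← integral_const_mul]
    refine integral_congr_ae (Eventually.of_forall fun x => ?_)
    simp only [hr]; ring
  have hzero : Tendsto (fun t : ℝ≥0 => ∫ x, f x * r t x ∂μ) (𝓝[>] (0 : ℝ≥0)) (𝓝 0) := by
    have hb : Tendsto (fun t : ℝ≥0 => (eLpNorm f 2 μ * eLpNorm (r t) 2 μ).toReal)
        (𝓝[>] (0 : ℝ≥0)) (𝓝 0) := by
      have h1 := ENNReal.Tendsto.const_mul (a := eLpNorm f 2 μ) hlim (Or.inr hf.2.ne)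
      rw [mul_zero] at h1
      exact (ENNReal.tendsto_toReal ENNReal.zero_ne_top).comp h1
    refine squeeze_zero_norm' ?_ hb
    filter_upwards [hfin] with t ht
    have h2 : eLpNorm (fun x => f x * r t x) 1 μ ≤ eLpNorm f 2 μ * eLpNorm (r t) 2 μ := by
      have h5 := eLpNorm_smul_le_mul_eLpNorm (p := 2) (q := 2) (r := 1) ht.1 hf.1
      have h6 : (f • r t) = fun x => f x * r t x := rfl
      rwa [h6] at h5
    have h3 : ‖∫ x, f x * r t x ∂μ‖ₑ ≤ eLpNorm (fun x => f x * r t x) 1 μ := by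
      rw [eLpNorm_one_eq_lintegral_enorm]; exact enorm_integral_le_lintegral_enorm _
    have h4 := ENNReal.toReal_mono (ENNReal.mul_ne_top hf.2.ne ht.2.ne) (h3.trans h2)
    simpa using h4
  have : Tendsto (fun t : ℝ≥0 => -(∫ x, f x * g x ∂μ) - ∫ x, f x * r t x ∂μ) (𝓝[>] (0 : ℝ≥0))
      (𝓝 (-(∫ x, f x * g x ∂μ))) := by simpa using hzero.const_sub (-(∫ x, f x * g x ∂μ))
  exact this.congr' (key.mono fun t ht => ht.symm)

end MixtureHC

end

noncomputable section

namespace MixtureHC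

variable {Ω : Type*} [MeasurableSpace Ω]

/-- Bounded measurable real functions. -/
structure IsBddMeasurable (f : Ω → ℝ) : Prop where
  measurable : Measurable f
  bounded : ∃ C, ∀ x, |f x| ≤ C

namespace IsBddMeasurable

variable {f g : Ω → ℝ}

lemma integrable (hf : IsBddMeasurable f) (μ : Measure Ω) [IsFiniteMeasure μ] :
    Integrable f μ := by
  obtain ⟨C, hC⟩ := hf.bounded
  exact Integrable.of_bound hf.measurable.aestronglyMeasurable C (Eventually.of_forall hC)

lemma memLp (hf : IsBddMeasurable f) (p : ℝ≥0∞) (μ : Measure Ω) [IsFiniteMeasure μ] :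
    MemLp f p μ := by
  obtain ⟨C, hC⟩ := hf.bounded
  exact MemLp.of_bound hf.measurable.aestronglyMeasurable C (Eventually.of_forall hC)

lemma add (hf : IsBddMeasurable f) (hg : IsBddMeasurable g) :
    IsBddMeasurable (fun x => f x + g x) := by
  obtain ⟨C, hC⟩ := hf.bounded
  obtain ⟨D, hD⟩ := hg.bounded
  exact ⟨hf.measurable.add hg.measurable, C + D, fun x =>
    (abs_add_le _ _).trans (add_le_add (hC x) (hD x))⟩

lemma sub (hf : IsBddMeasurable f) (hg : IsBddMeasurable g) :
    IsBddMeasurable (fun x => f x - g x) := by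
  obtain ⟨C, hC⟩ := hf.bounded
  obtain ⟨D, hD⟩ := hg.bounded
  exact ⟨hf.measurable.sub hg.measurable, C + D, fun x =>
    (abs_sub _ _).trans (add_le_add (hC x) (hD x))⟩

lemma mul (hf : IsBddMeasurable f) (hg : IsBddMeasurable g) :
    IsBddMeasurable (fun x => f x * g x) := by
  obtain ⟨C, hC⟩ := hf.bounded
  obtain ⟨D, hD⟩ := hg.bounded
  refine ⟨hf.measurable.mul hg.measurable, C * D, fun x => ?_⟩
  rw [abs_mul]
  exact mul_le_mul (hC x) (hD x) (abs_nonneg _) ((abs_nonneg _).trans (hC x))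

lemma const_mul (hf : IsBddMeasurable f) (c : ℝ) : IsBddMeasurable (fun x => c * f x) := by
  obtain ⟨C, hC⟩ := hf.bounded
  refine ⟨hf.measurable.const_mul c, |c| * C, fun x => ?_⟩
  rw [abs_mul]
  exact mul_le_mul_of_nonneg_left (hC x) (abs_nonneg _)

lemma sq (hf : IsBddMeasurable f) : IsBddMeasurable (fun x => f x ^ 2) := by
  simpa only [pow_two] using hf.mul hf

lemma of_mem_Icc (hf : Measurable f) {a b : ℝ} (h : ∀ x, f x ∈ Set.Icc a b) :
    IsBddMeasurable f :=
  ⟨hf, max |a| |b|, fun x => abs_le_max_abs_abs (h x).1 (h x).2⟩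

/-- A measurable function that is continuous on `[a, b]`, composed with a measurable function
with values in `[a, b]`. -/
lemma comp_of_continuousOn {φ : ℝ → ℝ} (hφm : Measurable φ) {a b : ℝ}
    (hφ : ContinuousOn φ (Set.Icc a b)) (hf : Measurable f) (h : ∀ x, f x ∈ Set.Icc a b) :
    IsBddMeasurable (fun x => φ (f x)) := by
  obtain ⟨C, hC⟩ := isCompact_Icc.exists_bound_of_continuousOn hφ
  exact ⟨hφm.comp hf, C, fun x => hC _ (h x)⟩

lemma act (hf : IsBddMeasurable f) (κ : Kernel Ω Ω) [IsMarkovKernel κ] :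
    IsBddMeasurable (act κ f) := by
  obtain ⟨C, hC⟩ := hf.bounded
  refine ⟨hf.measurable.stronglyMeasurable.integral_kernel.measurable, C, fun x => ?_⟩
  have := norm_integral_le_of_norm_le_const (μ := κ x) (f := f) (Eventually.of_forall hC)
  simpa [MixtureHC.act] using this

end IsBddMeasurable

section Kernel

variable {κ η : Kernel Ω Ω} {μ : Measure Ω}
  {f g : Ω → ℝ}

lemma act_sub [IsMarkovKernel κ] (hf : IsBddMeasurable f) (hg : IsBddMeasurable g) (x : Ω) :
    act κ (fun y => f y - g y) x = act κ f x - act κ g x :=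
  integral_sub (hf.integrable _) (hg.integrable _)

lemma act_mem_Icc [IsMarkovKernel κ] {a b : ℝ} (hf : Measurable f)
    (h : ∀ x, f x ∈ Set.Icc a b) (x : Ω) :
    act κ f x ∈ Set.Icc a b := by
  have hi := (IsBddMeasurable.of_mem_Icc hf h).integrable (κ x)
  constructor
  · simpa [act] using integral_mono (integrable_const a) hi (fun y => (h y).1)
  · simpa [act] using integral_mono hi (integrable_const b) (fun y => (h y).2)

lemma act_comp {x : Ω} (hf : Integrable f ((κ ∘ₖ η) x)) :
    act (κ ∘ₖ η) f x = act η (act κ f) x :=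
  Kernel.integral_comp hf

lemma sq_act_le [IsMarkovKernel κ] (hf : IsBddMeasurable f) (x : Ω) :
    act κ f x ^ 2 ≤ act κ (fun y => f y ^ 2) x := by
  have h : 0 ≤ ∫ y, (f y - act κ f x) ^ 2 ∂(κ x) := integral_nonneg fun _ => sq_nonneg _
  have e : ∀ y, (f y - act κ f x) ^ 2
      = f y ^ 2 - (2 * act κ f x) * f y + act κ f x ^ 2 := fun y => by ring
  simp_rw [e] at h
  rw [integral_add ((hf.sq.sub (hf.const_mul _)).integrable _) (integrable_const _),
    integral_sub (hf.sq.integrable _) ((hf.const_mul _).integrable _), integral_const_mul] at h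
  simp only [integral_const, probReal_univ, one_smul] at h
  change 0 ≤ act κ (fun y => f y ^ 2) x - 2 * act κ f x * act κ f x + _ at h
  linarith

lemma ae_integrable_of_invariant (hκ : κ.Invariant μ) (hf : Integrable f μ) :
    ∀ᵐ x ∂μ, Integrable f (κ x) := by
  apply Measure.ae_integrable_of_integrable_comp
  rwa [hκ.def]

lemma integral_act (hκ : κ.Invariant μ) (hf : Integrable f μ) :
    ∫ x, act κ f x ∂μ = ∫ x, f x ∂μ := by
  have h := hκ.def
  rw [Measure.comp_eq_comp_const_apply] at h
  have := Kernel.integral_comp (η := κ) (κ := Kernel.const Unit μ) (a := ()) (f := f)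
    (by rwa [h])
  rw [h] at this
  simpa [act] using this.symm

lemma act_ae_eq (hκ : κ.Invariant μ) (h : f =ᵐ[μ] g) : act κ f =ᵐ[μ] act κ g := by
  have h0 : ∀ᵐ y ∂(μ.bind κ), f y = g y := by rwa [hκ.def]
  filter_upwards [Measure.ae_ae_of_ae_bind κ.aemeasurable h0] with x hx
    using integral_congr_ae hx

lemma act_nonneg_ae (hκ : κ.Invariant μ) (h : ∀ᵐ x ∂μ, 0 ≤ f x) : ∀ᵐ x ∂μ, 0 ≤ act κ f x := by
  have h0 : ∀ᵐ y ∂(μ.bind κ), 0 ≤ f y := by rwa [hκ.def]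
  filter_upwards [Measure.ae_ae_of_ae_bind κ.aemeasurable h0] with x hx
    using integral_nonneg_of_ae hx

lemma integral_act_sq_le [IsMarkovKernel κ] [IsFiniteMeasure μ] (hκ : κ.Invariant μ)
    (hf : IsBddMeasurable f) :
    ∫ x, act κ f x ^ 2 ∂μ ≤ ∫ x, f x ^ 2 ∂μ := by
  rw [← integral_act hκ (hf.sq.integrable μ)]
  exact integral_mono ((hf.act κ).sq.integrable μ) ((hf.sq.act κ).integrable μ)
    (fun x => sq_act_le hf x)

lemma compProd_swap_of_isReversible [IsMarkovKernel κ] [IsFiniteMeasure μ] (hκ : κ.IsReversible μ) :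
    (μ ⊗ₘ κ).map Prod.swap = μ ⊗ₘ κ := by
  refine Measure.ext_prod fun {s t} hs ht => ?_
  rw [Measure.map_apply measurable_swap (hs.prod ht), Set.preimage_swap_prod,
    Measure.compProd_apply_prod ht hs, Measure.compProd_apply_prod hs ht]
  exact hκ ht hs

lemma integral_mul_act_comm [IsMarkovKernel κ] [IsFiniteMeasure μ] (hκ : κ.IsReversible μ)
    (hf : IsBddMeasurable f) (hg : IsBddMeasurable g) :
    ∫ x, f x * act κ g x ∂μ = ∫ x, act κ f x * g x ∂μ := by
  have key : ∀ {u v : Ω → ℝ}, IsBddMeasurable u → IsBddMeasurable v →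
      Integrable (fun z : Ω × Ω => u z.1 * v z.2) (μ ⊗ₘ κ) := by
    intro u v hu hv
    obtain ⟨C, hC⟩ := hu.bounded
    obtain ⟨D, hD⟩ := hv.bounded
    refine Integrable.of_bound (C := C * D) ((hu.measurable.comp measurable_fst).mul
      (hv.measurable.comp measurable_snd)).aestronglyMeasurable (Eventually.of_forall fun z => ?_)
    rw [Real.norm_eq_abs, abs_mul]
    exact mul_le_mul (hC _) (hD _) (abs_nonneg _) ((abs_nonneg _).trans (hC z.1))
  have h1 := Measure.integral_compProd (key hf hg)
  have h2 := Measure.integral_compProd (key hg hf)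
  simp only [integral_const_mul] at h1 h2
  calc ∫ x, f x * act κ g x ∂μ = ∫ z, f z.1 * g z.2 ∂(μ ⊗ₘ κ) := h1.symm
    _ = ∫ z, f z.1 * g z.2 ∂((μ ⊗ₘ κ).map Prod.swap) := by rw [compProd_swap_of_isReversible hκ]
    _ = ∫ z, g z.1 * f z.2 ∂(μ ⊗ₘ κ) := by
        rw [integral_map measurable_swap.aemeasurable]
        · exact integral_congr_ae (Eventually.of_forall fun z => mul_comm _ _)
        · rw [compProd_swap_of_isReversible hκ]; exact (key hf hg).aestronglyMeasurable
    _ = ∫ x, g x * act κ f x ∂μ := h2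
    _ = _ := integral_congr_ae (Eventually.of_forall fun z => mul_comm _ _)

/-- A pointwise inequality between increments of functions passes to the quadratic forms of a
reversible kernel. -/
lemma integral_mul_sub_act_le [IsMarkovKernel κ] [IsFiniteMeasure μ] (hκ : κ.IsReversible μ)
    {u v w : Ω → ℝ}
    (hu : IsBddMeasurable u) (hv : IsBddMeasurable v) (hw : IsBddMeasurable w) {c : ℝ}
    (h : ∀ x y, c * (w x - w y) ^ 2 ≤ (u x - u y) * (v x - v y)) :
    c * ∫ x, w x * (w x - act κ w x) ∂μ ≤ ∫ x, u x * (v x - act κ v x) ∂μ := by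
  have hinv := hκ.invariant
  have form : ∀ {a b : Ω → ℝ}, IsBddMeasurable a → IsBddMeasurable b → ∀ x,
      ∫ y, (a x - a y) * (b x - b y) ∂(κ x)
        = a x * (b x - act κ b x) - act κ a x * b x + act κ (fun y => a y * b y) x := by
    intro a b ha hb x
    have e : ∀ y, (a x - a y) * (b x - b y)
        = a x * b x - a x * b y - b x * a y + a y * b y := fun y => by ring
    simp_rw [e]
    have cst : ∀ t : ℝ, IsBddMeasurable (fun _ : Ω => t) := fun t =>
      ⟨measurable_const, |t|, fun _ => le_rfl⟩
    have i1 := (cst (a x * b x)).sub (hb.const_mul (a x))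
    rw [integral_add ((i1.sub (ha.const_mul (b x))).integrable _) ((ha.mul hb).integrable _),
      integral_sub (i1.integrable _) ((ha.const_mul (b x)).integrable _),
      integral_sub (integrable_const _) ((hb.const_mul _).integrable _)]
    simp only [integral_const_mul, integral_const, probReal_univ, one_smul, act]
    ring
  have bdd : ∀ {a b : Ω → ℝ}, IsBddMeasurable a → IsBddMeasurable b → IsBddMeasurable fun x =>
      a x * (b x - act κ b x) - act κ a x * b x + act κ (fun y => a y * b y) x :=
    fun ha hb => ((ha.mul (hb.sub (hb.act κ))).sub ((ha.act κ).mul hb)).add ((ha.mul hb).act κ)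
  have tot : ∀ {a b : Ω → ℝ}, IsBddMeasurable a → IsBddMeasurable b →
      ∫ x, (a x * (b x - act κ b x) - act κ a x * b x + act κ (fun y => a y * b y) x) ∂μ
        = 2 * ∫ x, a x * (b x - act κ b x) ∂μ := by
    intro a b ha hb
    rw [integral_add (((ha.mul (hb.sub (hb.act κ))).sub ((ha.act κ).mul hb)).integrable _)
        (((ha.mul hb).act κ).integrable _),
      integral_sub ((ha.mul (hb.sub (hb.act κ))).integrable _)
        (((ha.act κ).mul hb).integrable _),
      integral_act hinv ((ha.mul hb).integrable _), ← integral_mul_act_comm hκ ha hb]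
    have : ∫ x, a x * (b x - act κ b x) ∂μ = ∫ x, a x * b x ∂μ - ∫ x, a x * act κ b x ∂μ := by
      rw [← integral_sub ((ha.mul hb).integrable _) ((ha.mul (hb.act κ)).integrable _)]
      exact integral_congr_ae (Eventually.of_forall fun z => mul_sub _ _ _)
    rw [this]; ring
  have hmono : ∫ x, c * (w x * (w x - act κ w x) - act κ w x * w x
        + act κ (fun y => w y * w y) x) ∂μ
      ≤ ∫ x, (u x * (v x - act κ v x) - act κ u x * v x + act κ (fun y => u y * v y) x) ∂μ := by
    refine integral_mono (((bdd hw hw).const_mul c).integrable μ) ((bdd hu hv).integrable μ)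
      fun x => ?_
    simp only
    rw [← form hw hw x, ← form hu hv x, ← integral_const_mul]
    have cst : ∀ t : ℝ, IsBddMeasurable (fun _ : Ω => t) := fun t =>
      ⟨measurable_const, |t|, fun _ => le_rfl⟩
    refine integral_mono (((((cst _).sub hw).mul ((cst _).sub hw)).const_mul c).integrable _)
      ((((cst _).sub hu).mul ((cst _).sub hv)).integrable _) fun y => ?_
    simpa only [pow_two] using h x y
  rw [integral_const_mul, tot hw hw, tot hu hv] at hmono
  linarith

end Kernel

lemma sq_rpow_half_sub_le_of_le {q a b : ℝ} (hq : 1 < q) (hb : 0 < b) (hab : b ≤ a) :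
    4 * (q - 1) / q ^ 2 * (a ^ (q / 2) - b ^ (q / 2)) ^ 2
      ≤ (a ^ (q - 1) - b ^ (q - 1)) * (a - b) := by
  rcases hab.eq_or_lt with rfl | hlt
  · simp
  have ha : 0 < a := hb.trans hlt
  have hq0 : 0 < q := by linarith
  set l : ℝ := 2 / q * (a ^ (q / 2) - b ^ (q / 2)) / (a - b) with hl
  let φ : ℝ → ℝ := fun s => s ^ (q - 1) / (q - 1) + l ^ 2 * s - 4 * l / q * s ^ (q / 2)
  have hd : ∀ s, 0 < s → HasDerivAt φ ((s ^ (q / 2 - 1) - l) ^ 2) s := by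
    intro s hs
    have h1 := (Real.hasDerivAt_rpow_const (x := s) (p := q - 1) (Or.inl hs.ne')).div_const (q - 1)
    have h2 := (Real.hasDerivAt_rpow_const (x := s) (p := q / 2) (Or.inl hs.ne')).const_mul
      (4 * l / q)
    have h3 := (hasDerivAt_id s).const_mul (l ^ 2)
    refine ((h1.add h3).sub h2).congr_deriv ?_
    have e : s ^ (q - 1 - 1) = (s ^ (q / 2 - 1)) ^ 2 := by
      rw [← Real.rpow_natCast, ← Real.rpow_mul hs.le]; congr 1; push_cast; ring
    rw [e]
    have : q - 1 ≠ 0 := by linarith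
    field_simp
    ring
  have hmono : MonotoneOn φ (Set.Ioi 0) := by
    refine monotoneOn_of_deriv_nonneg (convex_Ioi 0)
      (fun s hs => (hd s hs).continuousAt.continuousWithinAt)
      (fun s hs => (hd s (interior_subset hs)).differentiableAt.differentiableWithinAt)
      fun s hs => ?_
    rw [(hd s (interior_subset hs)).deriv]
    positivity
  have h := hmono hb ha hab
  simp only [φ] at h
  have hsub : 0 < a - b := sub_pos.2 hlt
  have hq1 : 0 < q - 1 := by linarith
  have hl' : l * (a - b) = 2 / q * (a ^ (q / 2) - b ^ (q / 2)) := by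
    rw [hl]; field_simp
  set D := a ^ (q / 2) - b ^ (q / 2) with hD
  have h1 : 4 / q * l * D - l ^ 2 * (a - b) ≤ (a ^ (q - 1) - b ^ (q - 1)) / (q - 1) := by
    rw [hD, sub_div]
    have e : 4 / q * l * (a ^ (q / 2) - b ^ (q / 2))
        = 4 * l / q * a ^ (q / 2) - 4 * l / q * b ^ (q / 2) := by ring
    rw [e]
    linarith
  have h2 := mul_le_mul_of_nonneg_right h1 (mul_pos hsub hq1).le
  have e1 : (a ^ (q - 1) - b ^ (q - 1)) / (q - 1) * ((a - b) * (q - 1))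
      = (a ^ (q - 1) - b ^ (q - 1)) * (a - b) := by field_simp
  have e2 : (4 / q * l * D - l ^ 2 * (a - b)) * ((a - b) * (q - 1))
      = (q - 1) * (4 / q * D * (l * (a - b)) - (l * (a - b)) ^ 2) := by ring
  rw [e1, e2, hl'] at h2
  refine le_trans (le_of_eq ?_) h2
  field_simp
  ring

/-- The pointwise Stroock–Varopoulos inequality. -/
lemma sq_rpow_half_sub_le {q a b : ℝ} (hq : 1 < q) (ha : 0 < a) (hb : 0 < b) :
    4 * (q - 1) / q ^ 2 * (a ^ (q / 2) - b ^ (q / 2)) ^ 2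
      ≤ (a ^ (q - 1) - b ^ (q - 1)) * (a - b) := by
  rcases le_total b a with h | h
  · exact sq_rpow_half_sub_le_of_le hq hb h
  · have := sq_rpow_half_sub_le_of_le hq ha h
    nlinarith

lemma rpow_sub_rpow_le_mul_log {b : ℝ} (hb : 0 < b) (q₁ q₂ : ℝ) :
    b ^ q₂ - b ^ q₁ ≤ (q₂ - q₁) * (b ^ q₂ * Real.log b) := by
  have h := Real.add_one_le_exp ((q₁ - q₂) * Real.log b)
  have e : b ^ q₁ = b ^ q₂ * Real.exp ((q₁ - q₂) * Real.log b) := by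
    rw [mul_comm (q₁ - q₂), ← Real.rpow_def_of_pos hb, ← Real.rpow_add hb]; congr 1; ring
  rw [e]
  have := mul_le_mul_of_nonneg_left h (Real.rpow_pos_of_pos hb q₂).le
  linarith

lemma rpow_sub_rpow_le_mul_sub {q a b : ℝ} (hq : 1 < q) (ha : 0 < a) (hb : 0 < b) :
    b ^ q - a ^ q ≤ q * b ^ (q - 1) * (b - a) := by
  have h := one_add_mul_self_le_rpow_one_add (s := a / b - 1) (p := q)
    (by have := div_pos ha hb; linarith) hq.le
  rw [add_sub_cancel, Real.div_rpow ha.le hb.le, le_div_iff₀ (Real.rpow_pos_of_pos hb q)] at h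
  have e : b ^ q = b ^ (q - 1) * b := by
    rw [← Real.rpow_add_one hb.ne']; congr 1; ring
  have : q * (a / b - 1) * b ^ q = q * b ^ (q - 1) * (a - b) := by
    rw [e]; field_simp
  linarith

/-- Second-order upper bound for the increments of `x ↦ x ^ q` on a compact subinterval of
`(0, ∞)`. -/
lemma exists_rpow_sub_rpow_le {q m M : ℝ} (hq : 1 < q) (hm : 0 < m) :
    ∃ C, 0 ≤ C ∧ ∀ a ∈ Set.Icc m M, ∀ b ∈ Set.Icc m M,
      b ^ q - a ^ q ≤ q * a ^ (q - 1) * (b - a) + C * (b - a) ^ 2 := by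
  have hd : ∀ s ∈ Set.Icc m M, HasDerivWithinAt (fun x : ℝ => x ^ (q - 1))
      ((q - 1) * s ^ (q - 1 - 1)) (Set.Icc m M) s := fun s hs =>
    (Real.hasDerivAt_rpow_const (Or.inl (hm.trans_le hs.1).ne')).hasDerivWithinAt
  have hc : ContinuousOn (fun s : ℝ => (q - 1) * s ^ (q - 1 - 1)) (Set.Icc m M) :=
    continuousOn_const.mul (continuousOn_id.rpow_const fun s hs => Or.inl (hm.trans_le hs.1).ne')
  obtain ⟨K, hK⟩ := isCompact_Icc.exists_bound_of_continuousOn hc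
  refine ⟨q * |K|, by positivity, fun a ha b hb => ?_⟩
  have hlip := Convex.norm_image_sub_le_of_norm_hasDerivWithin_le hd hK (convex_Icc m M) ha hb
  have h1 := rpow_sub_rpow_le_mul_sub hq (hm.trans_le ha.1) (hm.trans_le hb.1)
  have h2 : (b ^ (q - 1) - a ^ (q - 1)) * (b - a) ≤ |K| * (b - a) ^ 2 := by
    calc (b ^ (q - 1) - a ^ (q - 1)) * (b - a)
        ≤ |b ^ (q - 1) - a ^ (q - 1)| * |b - a| := by rw [← abs_mul]; exact le_abs_self _
      _ ≤ (|K| * |b - a|) * |b - a| := by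
          refine mul_le_mul_of_nonneg_right (hlip.trans ?_) (abs_nonneg _)
          exact mul_le_mul_of_nonneg_right (le_abs_self K) (norm_nonneg _)
      _ = |K| * (b - a) ^ 2 := by rw [mul_assoc, ← pow_two, sq_abs]
  nlinarith

/-- The discrete entropy of a density against weights bounded below by `w₀`. -/
lemma sum_mul_log_sub_le {ι : Type*} [Fintype ι] {w a : ι → ℝ} {w₀ : ℝ} (h₀ : 0 < w₀)
    (hw : ∀ k, w₀ ≤ w k) (ha : ∀ k, 0 < a k) :
    ∑ k, w k * (a k * Real.log (a k))
      ≤ (∑ k, w k * a k) * Real.log (∑ k, w k * a k)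
        + (∑ k, w k * a k) * Real.log (1 / w₀) := by
  have hw' : ∀ k, 0 < w k := fun k => h₀.trans_le (hw k)
  rw [← mul_add, Finset.sum_mul]
  refine Finset.sum_le_sum fun k _ => ?_
  have hle : w k * a k ≤ ∑ j, w j * a j :=
    Finset.single_le_sum (f := fun j => w j * a j)
      (fun j _ => (mul_pos (hw' j) (ha j)).le) (Finset.mem_univ k)
  have hA : 0 < ∑ j, w j * a j := (mul_pos (hw' k) (ha k)).trans_le hle
  rw [← mul_assoc]
  refine mul_le_mul_of_nonneg_left ?_ (mul_pos (hw' k) (ha k)).le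
  rw [← Real.log_mul hA.ne' (by positivity)]
  refine Real.log_le_log (ha k) ?_
  rw [mul_one_div, le_div_iff₀ h₀]
  nlinarith [ha k, hw k]

/-- Convergence of integrals of uniformly bounded expressions `Φ x i (u i x)` along a family `u`
that converges in measure. -/
lemma tendsto_integral_of_tendstoInMeasure {μ : Measure Ω} [IsFiniteMeasure μ] {ι : Type*}
    {l : Filter ι} [l.IsCountablyGenerated] {u : ι → Ω → ℝ} {v : Ω → ℝ}
    (hu : TendstoInMeasure μ u l v) {Φ : Ω → ι → ℝ → ℝ} {Φ₀ : Ω → ℝ}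
    (hΦ : ∀ x, Tendsto (fun z : ι × ℝ => Φ x z.1 z.2) (l ×ˢ 𝓝 (v x)) (𝓝 (Φ₀ x)))
    (hm : ∀ i, Measurable fun x => Φ x i (u i x)) {C : ℝ}
    (hC : ∀ᶠ i in l, ∀ x, |Φ x i (u i x)| ≤ C) :
    Tendsto (fun i => ∫ x, Φ x i (u i x) ∂μ) l (𝓝 (∫ x, Φ₀ x ∂μ)) := by
  refine tendsto_of_subseq_tendsto fun ns hns => ?_
  obtain ⟨ms, hms, hae⟩ := TendstoInMeasure.exists_seq_tendsto_ae'
    (fun ε hε => (hu ε hε).comp hns : TendstoInMeasure μ (fun n => u (ns n)) atTop v)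
  refine ⟨ms, ?_⟩
  refine tendsto_integral_filter_of_dominated_convergence (fun _ => C)
    (Eventually.of_forall fun n => (hm _).aestronglyMeasurable) ?_ (integrable_const C) ?_
  · filter_upwards [(hns.comp hms).eventually hC] with n hn
    exact Eventually.of_forall hn
  · filter_upwards [hae] with x hx
    exact (hΦ x).comp ((hns.comp hms).prodMk hx)

lemma toReal_eLpNorm_two_sq {μ : Measure Ω} {u : Ω → ℝ} (hu : MemLp u 2 μ) :
    (eLpNorm u 2 μ).toReal ^ 2 = ∫ x, u x ^ 2 ∂μ := by
  have h0 : 0 ≤ ∫ x, u x ^ 2 ∂μ := integral_nonneg fun x => sq_nonneg _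
  rw [hu.eLpNorm_eq_integral_rpow_norm (by norm_num) (by norm_num)]
  simp only [ENNReal.toReal_ofNat, Real.rpow_ofNat, Real.norm_eq_abs, sq_abs]
  rw [ENNReal.toReal_ofReal (Real.rpow_nonneg h0 _), ← Real.rpow_natCast, ← Real.rpow_mul h0]
  norm_num

lemma tendstoInMeasure_of_tendsto_integral_sq {μ : Measure Ω} [IsFiniteMeasure μ] {ι : Type*}
    {l : Filter ι} {u : ι → Ω → ℝ} {v : Ω → ℝ} (hu : ∀ i, IsBddMeasurable (u i))
    (hv : IsBddMeasurable v)
    (h : Tendsto (fun i => ∫ x, (u i x - v x) ^ 2 ∂μ) l (𝓝 0)) : TendstoInMeasure μ u l v := by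
  refine tendstoInMeasure_of_tendsto_eLpNorm (p := 2) (by norm_num)
    (fun i => (hu i).measurable.aestronglyMeasurable) hv.measurable.aestronglyMeasurable ?_
  have e : ∀ i, eLpNorm (u i - v) 2 μ = ENNReal.ofReal (√(∫ x, (u i x - v x) ^ 2 ∂μ)) := by
    intro i
    have hm : MemLp (fun x => u i x - v x) 2 μ := ((hu i).sub hv).memLp 2 μ
    rw [← toReal_eLpNorm_two_sq hm, Real.sqrt_sq ENNReal.toReal_nonneg,
      ENNReal.ofReal_toReal hm.2.ne]
    rfl
  simp_rw [e]
  have := ENNReal.tendsto_ofReal ((Real.continuous_sqrt.tendsto 0).comp h)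
  simpa using this

namespace IsMarkovSemigroup

variable {P : ℝ≥0 → Kernel Ω Ω} {μ : Measure Ω} {f : Ω → ℝ}

lemma act_zero (hP : IsMarkovSemigroup P μ) (hf : Measurable f) : act (P 0) f = f := by
  ext x
  rw [act, hP.zero, Kernel.id_apply, integral_dirac' _ _ hf.stronglyMeasurable]

lemma bdd_act (hP : IsMarkovSemigroup P μ) (hf : IsBddMeasurable f) (t : ℝ≥0) :
    IsBddMeasurable (act (P t) f) := by
  have := hP.markov t
  exact hf.act _

lemma act_add (hP : IsMarkovSemigroup P μ) (hf : IsBddMeasurable f) (s t : ℝ≥0) :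
    act (P (s + t)) f = act (P s) (act (P t) f) := by
  have := hP.markov
  ext x
  rw [add_comm, hP.add]
  exact act_comp (hf.integrable _)

lemma act_add_ae (hP : IsMarkovSemigroup P μ) (hf : Integrable f μ) (s t : ℝ≥0) :
    act (P (s + t)) f =ᵐ[μ] act (P s) (act (P t) f) := by
  have := hP.markov
  filter_upwards [ae_integrable_of_invariant (hP.invariant (t + s)) hf] with x hx
  rw [hP.add] at hx
  rw [add_comm, hP.add]
  exact act_comp hx

lemma integral_sq_act_sub_le [IsFiniteMeasure μ] (hP : IsMarkovSemigroup P μ)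
    (hf : IsBddMeasurable f) (s t r : ℝ≥0) :
    ∫ x, (act (P (r + s)) f x - act (P (r + t)) f x) ^ 2 ∂μ
      ≤ ∫ x, (act (P s) f x - act (P t) f x) ^ 2 ∂μ := by
  have := hP.markov r
  have h := integral_act_sq_le (hP.invariant r) ((hP.bdd_act hf s).sub (hP.bdd_act hf t))
  simp_rw [MixtureHC.act_sub (hP.bdd_act hf s) (hP.bdd_act hf t), ← hP.act_add hf] at h
  exact h

lemma tendsto_integral_sq_act_sub [IsFiniteMeasure μ] (hP : IsMarkovSemigroup P μ)
    (hf : IsBddMeasurable f) :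
    Tendsto (fun t => ∫ x, (act (P t) f x - f x) ^ 2 ∂μ) (𝓝 0) (𝓝 0) := by
  have h0 : ∫ x, (act (P 0) f x - f x) ^ 2 ∂μ = 0 := by simp [hP.act_zero hf.measurable]
  have h1 : ContinuousWithinAt (fun t => ∫ x, (act (P t) f x - f x) ^ 2 ∂μ) (Set.Ioi 0) 0 := by
    rw [ContinuousWithinAt, h0]
    have h := hP.continuous f (hf.memLp 2 μ)
    have h2 := ((ENNReal.tendsto_toReal ENNReal.zero_ne_top).comp h).pow 2
    simp only [ENNReal.toReal_zero, ne_eq, OfNat.ofNat_ne_zero, not_false_eq_true,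
      zero_pow] at h2
    refine h2.congr fun t => ?_
    exact toReal_eLpNorm_two_sq (((hP.bdd_act hf t).sub hf).memLp 2 μ)
  rw [continuousWithinAt_Ioi_iff_Ici] at h1
  have hu : Set.Ici (0 : ℝ≥0) = Set.univ := Set.eq_univ_of_forall fun x => (zero_le : 0 ≤ x)
  rwa [hu, continuousWithinAt_univ, ContinuousAt, h0] at h1

lemma tendstoInMeasure_act [IsFiniteMeasure μ] (hP : IsMarkovSemigroup P μ)
    (hf : IsBddMeasurable f) (t : ℝ≥0) :
    TendstoInMeasure μ (fun s => act (P s) f) (𝓝 t) (act (P t) f) := by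
  refine tendstoInMeasure_of_tendsto_integral_sq (fun s => hP.bdd_act hf s) (hP.bdd_act hf t) ?_
  have h0 : Tendsto (fun s : ℝ≥0 => nndist s t) (𝓝 t) (𝓝 0) := by
    have : Continuous fun s : ℝ≥0 => nndist s t := by fun_prop
    simpa using this.tendsto t
  refine squeeze_zero (fun s => integral_nonneg fun x => sq_nonneg _) (fun s => ?_)
    ((hP.tendsto_integral_sq_act_sub hf).comp h0)
  have hz := hP.act_zero hf.measurable
  rcases le_total s t with h | h
  · have e : t = s + nndist s t := by
      rw [NNReal.nndist_eq, tsub_eq_zero_of_le h, max_eq_right (zero_le), add_tsub_cancel_of_le h]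
    have := hP.integral_sq_act_sub_le hf 0 (nndist s t) s
    rw [add_zero, ← e, hz] at this
    refine this.trans (le_of_eq (integral_congr_ae (Eventually.of_forall fun x => ?_)))
    simp only
    ring
  · have e : s = t + nndist s t := by
      rw [NNReal.nndist_eq, tsub_eq_zero_of_le h, max_eq_left (zero_le), add_tsub_cancel_of_le h]
    have := hP.integral_sq_act_sub_le hf (nndist s t) 0 t
    rwa [add_zero, ← e, hz] at this

end IsMarkovSemigroup

namespace IsReversibleMarkovSemigroup

variable {P : ℝ≥0 → Kernel Ω Ω} {μ : Measure Ω} [IsFiniteMeasure μ] {f : Ω → ℝ}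

lemma integral_act_mul_act (hP : IsReversibleMarkovSemigroup P μ) (hf : IsBddMeasurable f)
    (s t : ℝ≥0) :
    ∫ x, act (P s) f x * act (P t) f x ∂μ = ∫ x, f x * act (P (s + t)) f x ∂μ := by
  have := hP.markov s
  rw [← integral_mul_act_comm (hP.reversible s) hf (hP.bdd_act hf t), hP.act_add hf]

lemma antitone_integral_mul_act (hP : IsReversibleMarkovSemigroup P μ) (hf : IsBddMeasurable f) :
    Antitone fun t => ∫ x, f x * act (P t) f x ∂μ := by
  intro s t hst
  have h : ∀ r : ℝ≥0, ∫ x, f x * act (P r) f x ∂μ = ∫ x, act (P (r / 2)) f x ^ 2 ∂μ := by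
    intro r
    simp_rw [pow_two, hP.integral_act_mul_act hf, add_halves]
  simp only [h]
  have e : t / 2 = (t - s) / 2 + s / 2 := by
    rw [← add_div, tsub_add_cancel_of_le hst]
  have := hP.markov ((t - s) / 2)
  rw [e, hP.act_add hf]
  exact integral_act_sq_le (hP.invariant _) (hP.bdd_act hf _)

lemma integral_sq_act_sub_act (hP : IsReversibleMarkovSemigroup P μ) (hf : IsBddMeasurable f)
    (s h : ℝ≥0) :
    ∫ x, (act (P (s + h)) f x - act (P s) f x) ^ 2 ∂μ
      = (∫ x, f x * act (P (2 * s)) f x ∂μ) - 2 * (∫ x, f x * act (P (2 * s + h)) f x ∂μ)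
        + ∫ x, f x * act (P (2 * s + 2 * h)) f x ∂μ := by
  have b := hP.bdd_act hf
  have e : ∀ x, (act (P (s + h)) f x - act (P s) f x) ^ 2
      = act (P s) f x * act (P s) f x - 2 * (act (P s) f x * act (P (s + h)) f x)
        + act (P (s + h)) f x * act (P (s + h)) f x := fun x => by ring
  simp_rw [e]
  rw [integral_add ((((b s).mul (b s)).sub (((b s).mul (b (s + h))).const_mul 2)).integrable μ)
      (((b (s + h)).mul (b (s + h))).integrable μ),
    integral_sub (((b s).mul (b s)).integrable μ)
      ((((b s).mul (b (s + h))).const_mul 2).integrable μ), integral_const_mul]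
  simp only [hP.integral_act_mul_act hf]
  ring_nf

/-- For `t > 0` the increments `P (t + h) f - P t f` are `o(√h)` in `L²`. -/
lemma tendsto_integral_sq_act_sub_div (hP : IsReversibleMarkovSemigroup P μ)
    (hf : IsBddMeasurable f) {t : ℝ≥0} (ht : 0 < t) :
    Tendsto (fun h : ℝ≥0 => (h : ℝ)⁻¹ * ∫ x, (act (P (t + h)) f x - act (P t) f x) ^ 2 ∂μ)
      (𝓝[>] 0) (𝓝 0) := by
  set ψ : ℝ≥0 → ℝ := fun s => ∫ x, f x * act (P s) f x ∂μ with hψ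
  have hanti : Antitone ψ := hP.antitone_integral_mul_act hf
  have hlim : Tendsto (fun h : ℝ≥0 => (ψ 0 - ψ h) / t) (𝓝[>] 0) (𝓝 0) := by
    obtain ⟨C, hC⟩ := hf.bounded
    have h1 := tendsto_integral_of_tendstoInMeasure (hP.tendstoInMeasure_act hf 0)
      (Φ := fun x _ y => f x * y) (Φ₀ := fun x => f x * act (P 0) f x) (C := C * C)
      (fun x => (tendsto_snd.const_mul (f x)))
      (fun s => (hf.mul (hP.bdd_act hf s)).measurable)
      (Eventually.of_forall fun s x => by
        have := hP.markov s
        have hb := act_mem_Icc (κ := P s) hf.measurable (fun y => abs_le.1 (hC y)) x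
        rw [abs_mul]
        exact mul_le_mul (hC x) (abs_le.2 hb) (abs_nonneg _) ((abs_nonneg _).trans (hC x)))
    have h2 : Tendsto ψ (𝓝 0) (𝓝 (ψ 0)) := h1
    have h3 := ((h2.const_sub (ψ 0)).div_const (t : ℝ)).mono_left
      (nhdsWithin_le_nhds (s := Set.Ioi 0))
    simpa using h3
  refine squeeze_zero' (Eventually.of_forall fun h => mul_nonneg (by positivity)
    (integral_nonneg fun x => sq_nonneg _)) ?_ hlim
  filter_upwards [self_mem_nhdsWithin, nhdsWithin_le_nhds (Iic_mem_nhds ht)] with h hh0 hht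
  have hh0 : 0 < h := hh0
  have hht : h ≤ t := hht
  set e : ℝ≥0 → ℝ := fun s => ∫ x, (act (P (s + h)) f x - act (P s) f x) ^ 2 ∂μ with he
  have hepos : ∀ s, 0 ≤ e s := fun s => integral_nonneg fun x => sq_nonneg _
  have hanti_e : Antitone e := by
    intro s s' hs
    have h1 := hP.integral_sq_act_sub_le hf (s + h) s (s' - s)
    rwa [← add_assoc, tsub_add_cancel_of_le hs] at h1
  have htel : ∀ n : ℕ, ∑ j ∈ Finset.range n, e (j * h / 2)
      = ψ 0 - ψ h - (ψ (n * h) - ψ ((n + 1) * h)) := by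
    intro n
    induction n with
    | zero => simp
    | succ n ih =>
      rw [Finset.sum_range_succ, ih]
      have h1 := hP.integral_sq_act_sub_act hf (n * h / 2) h
      have h2 : 2 * (n * h / 2) = n * h := by
        rw [mul_div_cancel₀ _ (two_ne_zero)]
      rw [h2] at h1
      have h3 : (n : ℝ≥0) * h + h = (n + 1) * h := by ring
      have h4 : (n : ℝ≥0) * h + 2 * h = (n + 1 + 1) * h := by ring
      rw [h3, h4] at h1
      simp only [he, hψ, Nat.cast_succ]
      rw [h1]
      ring
  set n := ⌊2 * t / h⌋₊ with hn
  have hnle : (n : ℝ≥0) * h ≤ 2 * t := by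
    rw [← le_div_iff₀ hh0]; exact Nat.floor_le (zero_le)
  have hnge : t ≤ n * h := by
    have h1 : 2 * t < (n + 1) * h := by
      rw [← div_lt_iff₀ hh0]; exact Nat.lt_floor_add_one _
    have h2 : t + t < n * h + h := by linarith
    have h3 : t + t < n * h + t := h2.trans_le (by gcongr)
    exact (add_lt_add_iff_right t |>.1 h3).le
  have hsum : (n : ℝ) * e t ≤ ψ 0 - ψ h := by
    have h1 : (n : ℝ) * e t ≤ ∑ j ∈ Finset.range n, e (j * h / 2) := by
      have hc : (n : ℝ) * e t = ∑ _j ∈ Finset.range n, e t := by simp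
      rw [hc]
      refine Finset.sum_le_sum fun j hj => ?_
      apply hanti_e
      have hj' : (j : ℝ≥0) ≤ n := by exact_mod_cast (Finset.mem_range.1 hj).le
      rw [div_le_iff₀ two_pos, mul_comm t]
      exact (mul_le_mul_left hj' h).trans hnle
    rw [htel] at h1
    have h2 : ψ ((n + 1) * h) ≤ ψ (n * h) := hanti (by gcongr; simp)
    linarith
  have ht' : (0 : ℝ) < t := ht
  have hh' : (0 : ℝ) < h := hh0
  rw [inv_mul_le_iff₀ hh', ← mul_div_assoc, le_div_iff₀ ht']
  have hnge' : (t : ℝ) ≤ n * h := by exact_mod_cast hnge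
  calc e t * t ≤ e t * (n * h) := mul_le_mul_of_nonneg_left hnge' (hepos t)
    _ = h * (n * e t) := by ring
    _ ≤ h * (ψ 0 - ψ h) := mul_le_mul_of_nonneg_left hsum hh'.le

end IsReversibleMarkovSemigroup

/-- The defective log-Sobolev inequality `Ent_μ(u²) ≤ 2 C 𝓔(u, u) + K ∫ u² dμ`, for functions that
are bounded and bounded away from zero. -/
def DefectiveLogSobolev (P : ℝ≥0 → Kernel Ω Ω) (μ : Measure Ω) (C K : ℝ) : Prop :=
  ∀ (u : Ω → ℝ) (m M : ℝ), Measurable u → 0 < m → (∀ x, u x ∈ Set.Icc m M) →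
    ENNReal.ofReal ((∫ x, u x ^ 2 * Real.log (u x ^ 2) ∂μ)
        - (∫ x, u x ^ 2 ∂μ) * Real.log (∫ x, u x ^ 2 ∂μ) - K * ∫ x, u x ^ 2 ∂μ)
      ≤ ENNReal.ofReal (2 * C) * dirichletForm P μ u

lemma ofReal_sum_le {ι : Type*} (s : Finset ι) (a : ι → ℝ) :
    ENNReal.ofReal (∑ k ∈ s, a k) ≤ ∑ k ∈ s, ENNReal.ofReal (a k) := by
  classical
  induction s using Finset.induction_on with
  | empty => simp
  | insert k s hk ih =>
    rw [Finset.sum_insert hk, Finset.sum_insert hk]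
    exact ENNReal.ofReal_add_le.trans (add_le_add_right ih _)

lemma integral_mixture {ι : Type*} [Fintype ι] {w : ι → ℝ} (hw : ∀ k, 0 < w k)
    {ν : ι → Measure Ω} [∀ k, IsProbabilityMeasure (ν k)] {g : Ω → ℝ} (hg : IsBddMeasurable g) :
    ∫ x, g x ∂(∑ k, ENNReal.ofReal (w k) • ν k) = ∑ k, w k * ∫ x, g x ∂(ν k) := by
  rw [integral_finsetSum_measure fun k _ => (hg.integrable (ν k)).smul_measure
    ENNReal.ofReal_ne_top]
  simp_rw [integral_smul_measure, ENNReal.toReal_ofReal (hw _).le, smul_eq_mul]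

lemma defectiveLogSobolev_mixture {ι : Type*} [Fintype ι] {w : ι → ℝ} (hw : ∀ k, 0 < w k)
    {ν : ι → Measure Ω} [∀ k, IsProbabilityMeasure (ν k)] {μ : Measure Ω} [IsFiniteMeasure μ]
    (hμ : μ = ∑ k, ENNReal.ofReal (w k) • ν k)
    {P : ℝ≥0 → Kernel Ω Ω} {R : ι → ℝ≥0 → Kernel Ω Ω}
    (hdec : ∀ f : Ω → ℝ, MemLp f 2 μ →
      ∑ k, ENNReal.ofReal (w k) * dirichletForm (R k) (ν k) f ≤ dirichletForm P μ f)
    {c : ι → ℝ} (hLSI : ∀ k, LogSobolev (R k) (ν k) (c k)) {C : ℝ} (hC : ∀ k, c k ≤ C)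
    {w₀ : ℝ} (h₀ : 0 < w₀) (hw₀ : ∀ k, w₀ ≤ w k) :
    DefectiveLogSobolev P μ C (Real.log (1 / w₀)) := by
  intro u m M hu hm huM
  have bu : IsBddMeasurable u := .of_mem_Icc hu huM
  have bu2 : IsBddMeasurable fun x => u x ^ 2 := bu.sq
  have bl : IsBddMeasurable fun x => u x ^ 2 * Real.log (u x ^ 2) := by
    refine bu2.mul (IsBddMeasurable.comp_of_continuousOn (φ := fun y => Real.log (y ^ 2))
      (by fun_prop) ?_ hu huM)
    refine ContinuousOn.log (by fun_prop) fun y hy => ?_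
    have := hm.trans_le hy.1
    positivity
  have hpos : ∀ k, 0 < ∫ x, u x ^ 2 ∂(ν k) := by
    intro k
    have h1 : ∫ _x, m ^ 2 ∂(ν k) ≤ ∫ x, u x ^ 2 ∂(ν k) :=
      integral_mono (integrable_const _) (bu2.integrable _)
        fun x => pow_le_pow_left₀ hm.le (huM x).1 2
    simp only [integral_const, probReal_univ, one_smul] at h1
    exact (by positivity : 0 < m ^ 2).trans_le h1
  have hsum := sum_mul_log_sub_le h₀ hw₀ hpos
  have hle : (∫ x, u x ^ 2 * Real.log (u x ^ 2) ∂μ)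
        - (∫ x, u x ^ 2 ∂μ) * Real.log (∫ x, u x ^ 2 ∂μ) - Real.log (1 / w₀) * ∫ x, u x ^ 2 ∂μ
      ≤ ∑ k, w k * ((∫ x, u x ^ 2 * Real.log (u x ^ 2) ∂(ν k))
        - (∫ x, u x ^ 2 ∂(ν k)) * Real.log (∫ x, u x ^ 2 ∂(ν k))) := by
    simp_rw [mul_sub, Finset.sum_sub_distrib]
    rw [hμ, integral_mixture hw bl, integral_mixture hw bu2]
    linarith
  calc _ ≤ ENNReal.ofReal (∑ k, w k * ((∫ x, u x ^ 2 * Real.log (u x ^ 2) ∂(ν k))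
        - (∫ x, u x ^ 2 ∂(ν k)) * Real.log (∫ x, u x ^ 2 ∂(ν k)))) := ENNReal.ofReal_le_ofReal hle
    _ ≤ ∑ k, ENNReal.ofReal (w k * ((∫ x, u x ^ 2 * Real.log (u x ^ 2) ∂(ν k))
        - (∫ x, u x ^ 2 ∂(ν k)) * Real.log (∫ x, u x ^ 2 ∂(ν k)))) := ofReal_sum_le _ _
    _ ≤ ∑ k, ENNReal.ofReal (2 * C) * (ENNReal.ofReal (w k) * dirichletForm (R k) (ν k) u) := by
        refine Finset.sum_le_sum fun k _ => ?_
        have h1 := hLSI k u (bu.memLp 2 _)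
        rw [entropy, if_pos (bl.integrable (ν k))] at h1
        rw [ENNReal.ofReal_mul (hw k).le, mul_left_comm]
        gcongr
        refine h1.trans ?_
        gcongr
        exact hC k
    _ ≤ _ := by
        rw [← Finset.mul_sum]
        gcongr
        exact hdec u (bu.memLp 2 _)

section Exponent

lemma hcExponent_zero (p C : ℝ) : hcExponent p C 0 = p := by simp [hcExponent]

lemma one_lt_hcExponent {p : ℝ} (hp : 1 < p) (C : ℝ) (t : ℝ≥0) : 1 < hcExponent p C t := by
  have := mul_pos (sub_pos.2 hp) (Real.exp_pos (2 * t / C))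
  rw [hcExponent]
  linarith

lemma hcExponent_add (p C : ℝ) (s t : ℝ≥0) :
    hcExponent p C (s + t) = hcExponent (hcExponent p C s) C t := by
  simp only [hcExponent, NNReal.coe_add]
  rw [mul_add, add_div, Real.exp_add]
  ring

lemma continuous_hcExponent (p C : ℝ) : Continuous (hcExponent p C) := by
  unfold hcExponent
  fun_prop

lemma tendsto_hcExponent_slope (p C : ℝ) (t : ℝ≥0) :
    Tendsto (fun h : ℝ≥0 => (h : ℝ)⁻¹ * (hcExponent p C (t + h) - hcExponent p C t))
      (𝓝[>] 0) (𝓝 (2 * (hcExponent p C t - 1) / C)) := by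
  have hd : HasDerivAt (fun s : ℝ => 1 + (p - 1) * Real.exp (2 * s / C))
      (2 * (hcExponent p C t - 1) / C) (t : ℝ) := by
    have h1 := (((hasDerivAt_id (t : ℝ)).const_mul 2).div_const C).exp
    refine ((h1.const_mul (p - 1)).const_add 1).congr_deriv ?_
    simp only [hcExponent, id]
    ring
  have h2 := hasDerivAt_iff_tendsto_slope_zero.1 hd
  have h3 : Tendsto (fun h : ℝ≥0 => (h : ℝ)) (𝓝[>] 0) (𝓝[≠] 0) := by
    refine tendsto_nhdsWithin_iff.2 ⟨?_, ?_⟩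
    · exact (NNReal.continuous_coe.tendsto 0).mono_left nhdsWithin_le_nhds
    · filter_upwards [self_mem_nhdsWithin] with h hh
      have : (0 : ℝ) < h := hh
      exact this.ne'
  refine (h2.comp h3).congr fun h => ?_
  simp [hcExponent]

lemma continuousAt_rpow_hcExponent {m M : ℝ} (hm : 0 < m) (p C : ℝ) (t : ℝ≥0) {y : ℝ}
    (hy : y ∈ Set.Icc m M) :
    ContinuousAt (fun z : ℝ≥0 × ℝ => z.2 ^ hcExponent p C z.1) (t, y) :=
  continuousAt_snd.rpow ((continuous_hcExponent p C).comp continuous_fst).continuousAt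
    (Or.inl (hm.trans_le hy.1).ne')

end Exponent

namespace IsReversibleMarkovSemigroup

variable {P : ℝ≥0 → Kernel Ω Ω} {μ : Measure Ω} {f : Ω → ℝ} {m M : ℝ}

lemma act_mem (hP : IsReversibleMarkovSemigroup P μ) (hf : Measurable f)
    (hfM : ∀ x, f x ∈ Set.Icc m M) (t : ℝ≥0) (x : Ω) : act (P t) f x ∈ Set.Icc m M := by
  have := hP.markov t
  exact act_mem_Icc hf hfM x

lemma bdd_comp_act (hP : IsReversibleMarkovSemigroup P μ) (hf : Measurable f)
    (hfM : ∀ x, f x ∈ Set.Icc m M) {φ : ℝ → ℝ} (hφ : Measurable φ)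
    (hφc : ContinuousOn φ (Set.Icc m M)) (t : ℝ≥0) :
    IsBddMeasurable fun x => φ (act (P t) f x) :=
  .comp_of_continuousOn hφ hφc (hP.bdd_act (.of_mem_Icc hf hfM) t).measurable
    (hP.act_mem hf hfM t)

variable [IsProbabilityMeasure μ]

/-- Integrals of jointly continuous functions of time and of the semigroup are continuous in
time. -/
lemma continuous_integral_comp (hP : IsReversibleMarkovSemigroup P μ) (hf : Measurable f)
    (hfM : ∀ x, f x ∈ Set.Icc m M) {Φ : ℝ≥0 → ℝ → ℝ}
    (hΦ : ∀ t, ∀ y ∈ Set.Icc m M, ContinuousAt (fun z : ℝ≥0 × ℝ => Φ z.1 z.2) (t, y))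
    (hm : ∀ t, Measurable (Φ t)) :
    Continuous fun t => ∫ x, Φ t (act (P t) f x) ∂μ := by
  refine continuous_iff_continuousAt.2 fun t => ?_
  have hcomp : IsCompact (Metric.closedBall t 1 ×ˢ Set.Icc m M : Set (ℝ≥0 × ℝ)) :=
    (isCompact_closedBall t 1).prod isCompact_Icc
  obtain ⟨C, hC⟩ := hcomp.exists_bound_of_continuousOn (f := fun z : ℝ≥0 × ℝ => Φ z.1 z.2)
    fun z hz => (hΦ z.1 z.2 hz.2).continuousWithinAt
  have bf : IsBddMeasurable f := .of_mem_Icc hf hfM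
  refine tendsto_integral_of_tendstoInMeasure (hP.tendstoInMeasure_act bf t)
    (Φ := fun _ s y => Φ s y) (C := C) (fun x => ?_)
    (fun s => (hm s).comp (hP.bdd_act bf s).measurable) ?_
  · rw [← nhds_prod_eq]
    exact hΦ t _ (hP.act_mem hf hfM t x)
  · filter_upwards [Metric.closedBall_mem_nhds t one_pos] with s hs x
    exact hC (s, _) ⟨hs, hP.act_mem hf hfM s x⟩

lemma integral_rpow_act_pos (hP : IsReversibleMarkovSemigroup P μ) (hf : Measurable f)
    (hm : 0 < m) (hfM : ∀ x, f x ∈ Set.Icc m M) {q : ℝ} (hq : 0 ≤ q) (t : ℝ≥0) :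
    0 < ∫ x, act (P t) f x ^ q ∂μ := by
  have hb : IsBddMeasurable fun x => act (P t) f x ^ q :=
    hP.bdd_comp_act hf hfM (φ := fun y => y ^ q) (by fun_prop)
      (continuousOn_id.rpow_const fun s hs => Or.inl (hm.trans_le hs.1).ne') t
  have h1 : ∫ _x, m ^ q ∂μ ≤ ∫ x, act (P t) f x ^ q ∂μ :=
    integral_mono (integrable_const _) (hb.integrable _)
      fun x => Real.rpow_le_rpow hm.le (hP.act_mem hf hfM t x).1 hq
  simp only [integral_const, probReal_univ, one_smul] at h1
  exact (Real.rpow_pos_of_pos hm q).trans_le h1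

/-- Lower bounds on the Dirichlet form are attained by the difference quotients at arbitrarily
small times. -/
lemma frequently_lt_of_le_dirichletForm (hP : IsReversibleMarkovSemigroup P μ)
    {w : Ω → ℝ} (hw : IsBddMeasurable w) {C a e : ℝ} (hC : 0 < C)
    (h : ENNReal.ofReal e ≤ ENNReal.ofReal (2 * C) * dirichletForm P μ w) (ha : a < e / (2 * C)) :
    ∃ᶠ t : ℝ≥0 in 𝓝[>] 0, a < (t : ℝ)⁻¹ * ∫ x, w x * (w x - act (P t) w x) ∂μ := by
  have h2C : 0 < 2 * C := by linarith
  rcases lt_or_ge a 0 with h0 | h0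
  · refine Eventually.frequently (Eventually.of_forall fun t => h0.trans_le ?_)
    have := hP.markov t
    have := integral_mul_sub_act_le (hP.reversible t) hw hw hw (c := 0)
      fun x y => by rw [zero_mul]; exact mul_self_nonneg _
    rw [zero_mul] at this
    exact mul_nonneg (by positivity) this
  · have he : ENNReal.ofReal (e / (2 * C)) ≤ dirichletForm P μ w := by
      rw [ENNReal.ofReal_div_of_pos h2C]
      exact ENNReal.div_le_of_le_mul' h
    have hlt := ((ENNReal.ofReal_lt_ofReal_iff_of_nonneg h0).2 ha).trans_le he
    refine (frequently_lt_of_lt_limsup (by isBoundedDefault) hlt).mono fun t ht => ?_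
    exact (ENNReal.ofReal_lt_ofReal_iff_of_nonneg h0).1 ht

/-- Upper bound for the increments of `∫ (P t f) ^ q(t)`. -/
lemma exists_integral_rpow_sub_le (hP : IsReversibleMarkovSemigroup P μ) (hf : Measurable f)
    (hm : 0 < m) (hfM : ∀ x, f x ∈ Set.Icc m M) {p C : ℝ} (hp : 1 < p) (t : ℝ≥0) :
    ∃ D, ∀ h : ℝ≥0,
      (∫ x, act (P (t + h)) f x ^ hcExponent p C (t + h) ∂μ)
          - ∫ x, act (P t) f x ^ hcExponent p C t ∂μ
        ≤ (hcExponent p C (t + h) - hcExponent p C t)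
            * (∫ x, act (P (t + h)) f x ^ hcExponent p C (t + h)
                * Real.log (act (P (t + h)) f x) ∂μ)
          - 4 * (hcExponent p C t - 1) / hcExponent p C t
            * (∫ x, act (P t) f x ^ (hcExponent p C t / 2)
              * (act (P t) f x ^ (hcExponent p C t / 2)
                - act (P h) (fun y => act (P t) f y ^ (hcExponent p C t / 2)) x) ∂μ)
          + D * ∫ x, (act (P (t + h)) f x - act (P t) f x) ^ 2 ∂μ := by
  set q := hcExponent p C t with hq
  have hq1 : 1 < q := one_lt_hcExponent hp C t
  obtain ⟨D, -, hD⟩ := exists_rpow_sub_rpow_le (q := q) (m := m) (M := M) hq1 hm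
  refine ⟨D, fun h => ?_⟩
  set r := hcExponent p C (t + h) with hr
  have bf : IsBddMeasurable f := .of_mem_Icc hf hfM
  have pos : ∀ s x, 0 < act (P s) f x := fun s x => hm.trans_le (hP.act_mem hf hfM s x).1
  have bpow : ∀ (s : ℝ≥0) (a : ℝ), IsBddMeasurable fun x => act (P s) f x ^ a := fun s a =>
    hP.bdd_comp_act hf hfM (φ := fun y => y ^ a) (by fun_prop)
      (continuousOn_id.rpow_const fun s hs => Or.inl (hm.trans_le hs.1).ne') s
  have blog : IsBddMeasurable fun x => Real.log (act (P (t + h)) f x) :=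
    hP.bdd_comp_act hf hfM (φ := Real.log) (by fun_prop)
      (continuousOn_id.log fun s hs => (hm.trans_le hs.1).ne') _
  have b0 := hP.bdd_act bf t
  have b1 := hP.bdd_act bf (t + h)
  have := hP.markov h
  have hsv := integral_mul_sub_act_le (hP.reversible h) (bpow t (q - 1)) b0 (bpow t (q / 2))
    fun x y => sq_rpow_half_sub_le hq1 (pos t x) (pos t y)
  have hadd : ∀ x, act (P h) (act (P t) f) x = act (P (t + h)) f x := fun x => by
    rw [add_comm, hP.act_add bf]
  simp_rw [hadd] at hsv
  have hpt : ∀ x, act (P (t + h)) f x ^ r - act (P t) f x ^ q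
      ≤ (r - q) * (act (P (t + h)) f x ^ r * Real.log (act (P (t + h)) f x))
        - q * (act (P t) f x ^ (q - 1) * (act (P t) f x - act (P (t + h)) f x))
        + D * (act (P (t + h)) f x - act (P t) f x) ^ 2 := by
    intro x
    have h1 := rpow_sub_rpow_le_mul_log (pos (t + h) x) q r
    have h2 := hD _ (hP.act_mem hf hfM t x) _ (hP.act_mem hf hfM (t + h) x)
    linarith
  have i1 := ((bpow (t + h) r).mul blog).const_mul (r - q)
  have i2 := ((bpow t (q - 1)).mul (b0.sub b1)).const_mul q
  have i3 := (b1.sub b0).sq.const_mul D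
  have hint := integral_mono (((bpow (t + h) r).sub (bpow t q)).integrable μ)
    (((i1.sub i2).add i3).integrable μ) hpt
  rw [integral_sub ((bpow (t + h) r).integrable μ) ((bpow t q).integrable μ),
    integral_add ((i1.sub i2).integrable μ) (i3.integrable μ),
    integral_sub (i1.integrable μ) (i2.integrable μ), integral_const_mul, integral_const_mul,
    integral_const_mul] at hint
  have hq0 : 0 < q := by linarith
  have e : 4 * (q - 1) / q = q * (4 * (q - 1) / q ^ 2) := by field_simp
  rw [e, mul_assoc]
  have := mul_le_mul_of_nonneg_left hsv hq0.le
  linarith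

end IsReversibleMarkovSemigroup

namespace IsReversibleMarkovSemigroup

variable {P : ℝ≥0 → Kernel Ω Ω} {μ : Measure Ω} [IsProbabilityMeasure μ] {f : Ω → ℝ} {m M : ℝ}

/-- The logarithm of the `L^{q(t)}` norm of `P t f`, with the correction `K / q(t)`. -/
def logNorm (P : ℝ≥0 → Kernel Ω Ω) (μ : Measure Ω) (f : Ω → ℝ) (p C K : ℝ) (t : ℝ≥0) : ℝ :=
  (Real.log (∫ x, act (P t) f x ^ hcExponent p C t ∂μ) + K) / hcExponent p C t

lemma continuous_logNorm (hP : IsReversibleMarkovSemigroup P μ) (hf : Measurable f)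
    (hm : 0 < m) (hfM : ∀ x, f x ∈ Set.Icc m M) {p : ℝ} (hp : 1 < p) (C K : ℝ) :
    Continuous (logNorm P μ f p C K) := by
  have hF := hP.continuous_integral_comp hf hfM (Φ := fun t y => y ^ hcExponent p C t)
    (fun t y hy => continuousAt_rpow_hcExponent hm p C t hy) (fun t => by fun_prop)
  refine ((hF.log fun t => ?_).add continuous_const).div (continuous_hcExponent p C) fun t => ?_
  · exact (hP.integral_rpow_act_pos hf hm hfM
      (zero_le_one.trans (one_lt_hcExponent hp C t).le) t).ne'
  · exact (zero_lt_one.trans (one_lt_hcExponent hp C t)).ne'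

/-- The lower right Dini derivative of `logNorm` is nonpositive at positive times. -/
lemma frequently_logNorm_sub_lt (hP : IsReversibleMarkovSemigroup P μ) (hf : Measurable f)
    (hm : 0 < m) (hfM : ∀ x, f x ∈ Set.Icc m M) {p C K : ℝ} (hp : 1 < p) (hC : 0 < C)
    (hLS : DefectiveLogSobolev P μ C K) {t : ℝ≥0} (ht : 0 < t) {r : ℝ} (hr : 0 < r) :
    ∃ᶠ h : ℝ≥0 in 𝓝[>] 0,
      (h : ℝ)⁻¹ * (logNorm P μ f p C K (t + h) - logNorm P μ f p C K t) < r := by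
  obtain ⟨D, hD⟩ := hP.exists_integral_rpow_sub_le hf hm hfM (C := C) hp t
  have bf : IsBddMeasurable f := .of_mem_Icc hf hfM
  set F : ℝ≥0 → ℝ := fun s => ∫ x, act (P s) f x ^ hcExponent p C s ∂μ with hF
  set H : ℝ≥0 → ℝ := fun s =>
    ∫ x, act (P s) f x ^ hcExponent p C s * Real.log (act (P s) f x) ∂μ with hH
  set q := hcExponent p C t with hq
  set w : Ω → ℝ := fun x => act (P t) f x ^ (q / 2) with hw
  set Q : ℝ≥0 → ℝ := fun h => (h : ℝ)⁻¹ * ∫ x, w x * (w x - act (P h) w x) ∂μ with hQ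
  set R : ℝ≥0 → ℝ := fun h =>
    (h : ℝ)⁻¹ * ∫ x, (act (P (t + h)) f x - act (P t) f x) ^ 2 ∂μ with hR
  set δ : ℝ≥0 → ℝ := fun h => (h : ℝ)⁻¹ * (hcExponent p C (t + h) - q) with hδ
  have hq1 : 1 < q := one_lt_hcExponent hp C t
  have hq0 : 0 < q := by linarith
  have hqh : ∀ s, 0 < hcExponent p C s := fun s => zero_lt_one.trans (one_lt_hcExponent hp C s)
  have hFpos : ∀ s, 0 < F s := fun s => hP.integral_rpow_act_pos hf hm hfM (hqh s).le s
  have pos : ∀ s x, 0 < act (P s) f x := fun s x => hm.trans_le (hP.act_mem hf hfM s x).1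
  -- limits of the ingredients as `h → 0`
  have hshift : Tendsto (fun h : ℝ≥0 => t + h) (𝓝[>] 0) (𝓝 t) := by
    have : Continuous fun h : ℝ≥0 => t + h := by fun_prop
    simpa using (this.tendsto 0).mono_left (nhdsWithin_le_nhds (s := Set.Ioi 0))
  have hHlim : Tendsto (fun h => H (t + h)) (𝓝[>] 0) (𝓝 (H t)) := by
    have hc := hP.continuous_integral_comp hf hfM
      (Φ := fun t y => y ^ hcExponent p C t * Real.log y)
      (fun t y hy => (continuousAt_rpow_hcExponent hm p C t hy).mul
        (continuousAt_snd.log (hm.trans_le hy.1).ne')) (fun t => by fun_prop)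
    exact (hc.tendsto t).comp hshift
  have hqlim : Tendsto (fun h => hcExponent p C (t + h)) (𝓝[>] 0) (𝓝 q) :=
    ((continuous_hcExponent p C).tendsto t).comp hshift
  have hδlim : Tendsto δ (𝓝[>] 0) (𝓝 (2 * (q - 1) / C)) := tendsto_hcExponent_slope p C t
  have hRlim : Tendsto R (𝓝[>] 0) (𝓝 0) := hP.tendsto_integral_sq_act_sub_div bf ht
  -- the log-Sobolev inequality for `w = (P t f) ^ (q / 2)`
  have hwsq : ∀ x, w x ^ 2 = act (P t) f x ^ q := fun x => by
    rw [hw, ← Real.rpow_natCast, ← Real.rpow_mul (pos t x).le]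
    norm_num
  have hwm : Measurable w := (hP.bdd_act bf t).measurable.pow_const _
  have hwM : ∀ x, w x ∈ Set.Icc (m ^ (q / 2)) (M ^ (q / 2)) := fun x =>
    ⟨Real.rpow_le_rpow hm.le (hP.act_mem hf hfM t x).1 (by positivity),
      Real.rpow_le_rpow (pos t x).le (hP.act_mem hf hfM t x).2 (by positivity)⟩
  have hls := hLS w _ _ hwm (Real.rpow_pos_of_pos hm _) hwM
  simp_rw [hwsq, Real.log_rpow (pos t _), mul_left_comm _ q, integral_const_mul] at hls
  change ENNReal.ofReal (q * H t - F t * Real.log (F t) - K * F t) ≤ _ at hls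
  set e := q * H t - F t * Real.log (F t) - K * F t with he
  set a := e / (2 * C) - r * (F t * q ^ 2) / (8 * (q - 1)) with ha
  have hq1' : 0 < q - 1 := by linarith
  have hae : a < e / (2 * C) := by
    have := hFpos t
    rw [ha, sub_lt_self_iff]
    positivity
  have hfreq := hP.frequently_lt_of_le_dirichletForm (.of_mem_Icc hwm hwM) hC hls hae
  -- the upper bound for the difference quotient and its limit
  have hUlim : Tendsto (fun h => (δ h * H (t + h) - 4 * (q - 1) / q * a + D * R h)
        / (F t * hcExponent p C (t + h))
        - (Real.log (F t) + K) * δ h / (q * hcExponent p C (t + h))) (𝓝[>] 0)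
      (𝓝 ((2 * (q - 1) / C * H t - 4 * (q - 1) / q * a + D * 0) / (F t * q)
        - (Real.log (F t) + K) * (2 * (q - 1) / C) / (q * q))) := by
    have hFq : F t * q ≠ 0 := (mul_pos (hFpos t) hq0).ne'
    exact ((((hδlim.mul hHlim).sub_const _).add (hRlim.const_mul D)).div
      (hqlim.const_mul _) hFq).sub ((hδlim.const_mul _).div (hqlim.const_mul _)
        (mul_pos hq0 hq0).ne')
  have hval : (2 * (q - 1) / C * H t - 4 * (q - 1) / q * a + D * 0) / (F t * q)
        - (Real.log (F t) + K) * (2 * (q - 1) / C) / (q * q) = r / 2 := by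
    have := (hFpos t).ne'
    rw [ha, he]
    field_simp
    ring
  rw [hval] at hUlim
  refine (hfreq.and_eventually ((hUlim.eventually_lt_const (half_lt_self hr)).and
    self_mem_nhdsWithin)).mono ?_
  rintro h ⟨hQa, hU, hh⟩
  have hh : (0 : ℝ) < h := hh
  refine lt_of_le_of_lt ?_ hU
  set qh := hcExponent p C (t + h) with hqh'
  have hqh0 : 0 < qh := hqh _
  have hlog : Real.log (F (t + h)) - Real.log (F t) ≤ (F (t + h) - F t) / F t := by
    rw [← Real.log_div (hFpos _).ne' (hFpos _).ne', sub_div, div_self (hFpos t).ne']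
    exact Real.log_le_sub_one_of_pos (div_pos (hFpos _) (hFpos _))
  have hinc : (h : ℝ)⁻¹ * (F (t + h) - F t)
      ≤ δ h * H (t + h) - 4 * (q - 1) / q * a + D * R h := by
    have h1 := mul_le_mul_of_nonneg_left (hD h) (inv_pos.2 hh).le
    have h2 : 4 * (q - 1) / q * a ≤ 4 * (q - 1) / q * Q h :=
      mul_le_mul_of_nonneg_left hQa.le (by positivity)
    refine h1.trans (le_trans (le_of_eq ?_) (add_le_add_left (sub_le_sub_left h2 _) _))
    simp only [hδ, hR, hQ, hH]
    ring
  have hG : logNorm P μ f p C K (t + h) - logNorm P μ f p C K t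
      = (Real.log (F (t + h)) - Real.log (F t)) / qh
        - (Real.log (F t) + K) * (qh - q) / (q * qh) := by
    change (Real.log (F (t + h)) + K) / qh - (Real.log (F t) + K) / q = _
    field_simp
    ring
  calc (h : ℝ)⁻¹ * (logNorm P μ f p C K (t + h) - logNorm P μ f p C K t)
      ≤ (h : ℝ)⁻¹ * ((F (t + h) - F t) / F t / qh
          - (Real.log (F t) + K) * (qh - q) / (q * qh)) := by
        rw [hG]; gcongr
    _ = ((h : ℝ)⁻¹ * (F (t + h) - F t)) / (F t * qh)
          - (Real.log (F t) + K) * δ h / (q * qh) := by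
        simp only [hδ]
        rw [div_div]
        ring
    _ ≤ _ := by
        have := mul_pos (hFpos t) hqh0
        gcongr

lemma antitone_logNorm (hP : IsReversibleMarkovSemigroup P μ) (hf : Measurable f)
    (hm : 0 < m) (hfM : ∀ x, f x ∈ Set.Icc m M) {p C K : ℝ} (hp : 1 < p) (hC : 0 < C)
    (hLS : DefectiveLogSobolev P μ C K) (t : ℝ≥0) :
    logNorm P μ f p C K t ≤ logNorm P μ f p C K 0 := by
  set G := logNorm P μ f p C K with hG
  have hc : Continuous G := hP.continuous_logNorm hf hm hfM hp C K
  have hpos : ∀ s : ℝ≥0, 0 < s → s ≤ t → G t ≤ G s := by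
    intro s hs hst
    have hcr : Continuous fun x : ℝ => G x.toNNReal := hc.comp continuous_real_toNNReal
    have key := image_le_of_liminf_slope_right_le_deriv_boundary (f := fun x => G x.toNNReal)
      (a := s) (b := t) hcr.continuousOn (B := fun _ => G s) (B' := fun _ => 0)
      (by simp) continuousOn_const (fun x _ => hasDerivWithinAt_const _ _ _) ?_
      (x := t) ⟨hst, le_rfl⟩
    · simpa using key
    · intro x hx r hr
      have hx0 : 0 < x := lt_of_lt_of_le hs hx.1
      lift x to ℝ≥0 using hx0.le
      have hx0' : 0 < x := hx0
      have hmap : Tendsto (fun h : ℝ≥0 => (x : ℝ) + h) (𝓝[>] 0) (𝓝[>] (x : ℝ)) := by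
        refine tendsto_nhdsWithin_iff.2 ⟨?_, ?_⟩
        · have : Continuous fun h : ℝ≥0 => (x : ℝ) + h := by fun_prop
          simpa using (this.tendsto 0).mono_left (nhdsWithin_le_nhds (s := Set.Ioi 0))
        · filter_upwards [self_mem_nhdsWithin] with h hh
          have : (0 : ℝ) < h := hh
          simpa using this
      refine hmap.frequently ((hP.frequently_logNorm_sub_lt hf hm hfM hp hC hLS hx0' hr).mono ?_)
      intro h hh
      rw [slope_def_field, ← NNReal.coe_add, Real.toNNReal_coe, Real.toNNReal_coe, NNReal.coe_add,
        add_sub_cancel_left, div_eq_inv_mul]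
      exact hh
  rcases eq_or_ne t 0 with rfl | ht
  · exact le_rfl
  have ht0 : 0 < t := pos_iff_ne_zero.2 ht
  refine ge_of_tendsto ((hc.tendsto 0).mono_left (nhdsWithin_le_nhds (s := Set.Ioi 0))) ?_
  filter_upwards [self_mem_nhdsWithin, nhdsWithin_le_nhds (Iic_mem_nhds ht0)] with s hs hst
    using hpos s hs hst

end IsReversibleMarkovSemigroup

lemma eLpNorm_eq_exp_log {μ : Measure Ω} {u : Ω → ℝ} {q : ℝ} (hq : 0 < q)
    (hu : MemLp u (ENNReal.ofReal q) μ) (hu0 : ∀ x, 0 < u x) (hpos : 0 < ∫ x, u x ^ q ∂μ) :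
    eLpNorm u (ENNReal.ofReal q) μ
      = ENNReal.ofReal (Real.exp (Real.log (∫ x, u x ^ q ∂μ) / q)) := by
  rw [hu.eLpNorm_eq_integral_rpow_norm (by simpa using hq) ENNReal.ofReal_ne_top,
    ENNReal.toReal_ofReal hq.le]
  simp_rw [Real.norm_eq_abs, abs_of_pos (hu0 _)]
  rw [Real.rpow_def_of_pos hpos, div_eq_mul_inv]

namespace IsReversibleMarkovSemigroup

variable {P : ℝ≥0 → Kernel Ω Ω} {μ : Measure Ω} [IsProbabilityMeasure μ] {f : Ω → ℝ}

lemma eLpNorm_act_le_of_mem_Icc (hP : IsReversibleMarkovSemigroup P μ) (hf : Measurable f)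
    {m M : ℝ} (hm : 0 < m) (hfM : ∀ x, f x ∈ Set.Icc m M) {p C K : ℝ} (hp : 1 < p) (hC : 0 < C)
    (hLS : DefectiveLogSobolev P μ C K) (t : ℝ≥0) :
    eLpNorm (act (P t) f) (ENNReal.ofReal (hcExponent p C t)) μ
      ≤ ENNReal.ofReal (Real.exp (K * (1 / p - 1 / hcExponent p C t)))
        * eLpNorm f (ENNReal.ofReal p) μ := by
  have hq : 0 < hcExponent p C t := zero_lt_one.trans (one_lt_hcExponent hp C t)
  have hp0 : 0 < p := zero_lt_one.trans hp
  have bf : IsBddMeasurable f := .of_mem_Icc hf hfM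
  have h0 := hP.act_zero hf
  have hF0 := hP.integral_rpow_act_pos hf hm hfM hp0.le 0
  rw [h0] at hF0
  rw [eLpNorm_eq_exp_log hq ((hP.bdd_act bf t).memLp _ _)
      (fun x => hm.trans_le (hP.act_mem hf hfM t x).1)
      (hP.integral_rpow_act_pos hf hm hfM hq.le t),
    eLpNorm_eq_exp_log hp0 (bf.memLp _ _) (fun x => hm.trans_le (hfM x).1) hF0,
    ← ENNReal.ofReal_mul (Real.exp_pos _).le, ← Real.exp_add]
  refine ENNReal.ofReal_le_ofReal (Real.exp_le_exp.2 ?_)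
  have h := hP.antitone_logNorm hf hm hfM hp hC hLS t
  rw [logNorm, logNorm, hcExponent_zero, h0, add_div, add_div] at h
  have e : K * (1 / p - 1 / hcExponent p C t) = K / p - K / hcExponent p C t := by ring
  linarith

/-- Defective hypercontractivity: the defective log-Sobolev inequality bounds the norm of
`P t : L^p → L^{q(t)}` on nonnegative functions. -/
theorem eLpNorm_act_le (hP : IsReversibleMarkovSemigroup P μ) {p C K : ℝ} (hp : 1 < p)
    (hC : 0 < C) (hLS : DefectiveLogSobolev P μ C K) (hf : MemLp f (ENNReal.ofReal p) μ)
    (hf0 : ∀ᵐ x ∂μ, 0 ≤ f x) (t : ℝ≥0) :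
    eLpNorm (act (P t) f) (ENNReal.ofReal (hcExponent p C t)) μ
      ≤ ENNReal.ofReal (Real.exp (K * (1 / p - 1 / hcExponent p C t)))
        * eLpNorm f (ENNReal.ofReal p) μ := by
  have hMk := hP.markov t
  have hinv := hP.invariant t
  have hp1 : 1 ≤ ENNReal.ofReal p := by simpa using hp.le
  set g := hf.1.mk f with hg
  have hfg : f =ᵐ[μ] g := hf.1.ae_eq_mk
  have hgm : Measurable g := hf.1.stronglyMeasurable_mk.measurable
  have hgL : MemLp g (ENNReal.ofReal p) μ := (memLp_congr_ae hfg).1 hf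
  have hg0 : ∀ᵐ x ∂μ, 0 ≤ g x := by
    filter_upwards [hf0, hfg] with x h1 h2 using h2 ▸ h1
  rw [eLpNorm_congr_ae (act_ae_eq hinv hfg), eLpNorm_congr_ae hfg]
  set u : ℕ → Ω → ℝ := fun n x => max (min (g x) (n + 1)) (1 / ((n : ℝ) + 1)) with hu
  have hum : ∀ n : ℕ, Measurable (u n) := fun n => (hgm.min measurable_const).max measurable_const
  have huM : ∀ (n : ℕ) (x : Ω), u n x ∈ Set.Icc (1 / ((n : ℝ) + 1)) (n + 1) := by
    intro n x
    refine ⟨le_max_right _ _, max_le (min_le_right _ _) ?_⟩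
    have : (0 : ℝ) ≤ n := n.cast_nonneg
    rw [div_le_iff₀ (by positivity)]
    nlinarith
  have hub : ∀ (n : ℕ) (x : Ω), |u n x| ≤ |g x| + 1 / ((n : ℝ) + 1) := by
    intro n x
    have h1 : 0 < 1 / ((n : ℝ) + 1) := by positivity
    rw [abs_of_pos (h1.trans_le (huM n x).1)]
    refine max_le ?_ (le_add_of_nonneg_left (abs_nonneg _))
    exact (min_le_left _ _).trans ((le_abs_self _).trans (le_add_of_nonneg_right h1.le))
  have hulim : ∀ x, 0 ≤ g x → Tendsto (fun n => u n x) atTop (𝓝 (g x)) := by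
    intro x hx
    have h1 : Tendsto (fun n : ℕ => min (g x) ((n : ℝ) + 1)) atTop (𝓝 (g x)) := by
      refine tendsto_const_nhds.congr' ?_
      filter_upwards [eventually_ge_atTop ⌈g x⌉₊] with n hn
      have := Nat.ceil_le.1 hn
      rw [min_eq_left]
      linarith
    have h2 := h1.max (tendsto_one_div_add_atTop_nhds_zero_nat (𝕜 := ℝ))
    rwa [max_eq_left hx] at h2
  have hlim : ∀ᵐ x ∂μ, Tendsto (fun n => act (P t) (u n) x) atTop (𝓝 (act (P t) g x)) := by
    have h0 : ∀ᵐ y ∂(μ.bind (P t)), 0 ≤ g y := by rwa [hinv.def]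
    filter_upwards [ae_integrable_of_invariant hinv (hgL.integrable hp1),
      Measure.ae_ae_of_ae_bind (P t).aemeasurable h0] with x hx hx0
    refine tendsto_integral_of_dominated_convergence (fun y => |g y| + 1)
      (fun n => (hum n).aestronglyMeasurable) (hx.abs.add (integrable_const _))
      (fun n => Eventually.of_forall fun y => (hub n y).trans ?_) ?_
    · have : 1 / ((n : ℝ) + 1) ≤ 1 := by
        rw [div_le_one (by positivity)]
        linarith [(n.cast_nonneg : (0 : ℝ) ≤ n)]
      linarith
    · filter_upwards [hx0] with y hy using hulim y hy
  set A := ENNReal.ofReal (Real.exp (K * (1 / p - 1 / hcExponent p C t))) with hA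
  have hbound : ∀ n : ℕ, eLpNorm (act (P t) (u n)) (ENNReal.ofReal (hcExponent p C t)) μ
      ≤ A * (eLpNorm g (ENNReal.ofReal p) μ + ENNReal.ofReal (1 / ((n : ℝ) + 1))) := by
    intro n
    have h1 : 0 < 1 / ((n : ℝ) + 1) := by positivity
    refine (hP.eLpNorm_act_le_of_mem_Icc (hum n) h1 (huM n) hp hC hLS t).trans ?_
    gcongr
    have h2 : eLpNorm (u n) (ENNReal.ofReal p) μ
        ≤ eLpNorm ((fun x => |g x|) + fun _ => 1 / ((n : ℝ) + 1)) (ENNReal.ofReal p) μ := by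
      refine eLpNorm_mono fun x => ?_
      rw [Real.norm_eq_abs, Real.norm_eq_abs]
      exact (hub n x).trans (le_abs_self _)
    refine h2.trans ((eLpNorm_add_le hgL.abs.1 aestronglyMeasurable_const hp1).trans ?_)
    refine add_le_add (le_of_eq (eLpNorm_norm g)) (le_of_eq ?_)
    rw [eLpNorm_const _ (zero_lt_one.trans_le hp1).ne' (IsProbabilityMeasure.ne_zero μ)]
    rw [Real.enorm_eq_ofReal h1.le]
    simp
  have hfin : Tendsto (fun n : ℕ => A * (eLpNorm g (ENNReal.ofReal p) μ
      + ENNReal.ofReal (1 / ((n : ℝ) + 1)))) atTop (𝓝 (A * eLpNorm g (ENNReal.ofReal p) μ)) := by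
    have h1 := ENNReal.tendsto_ofReal (tendsto_one_div_add_atTop_nhds_zero_nat (𝕜 := ℝ))
    have h2 := h1.const_add (eLpNorm g (ENNReal.ofReal p) μ)
    rw [ENNReal.ofReal_zero, add_zero] at h2
    exact ENNReal.Tendsto.const_mul h2 (Or.inr ENNReal.ofReal_ne_top)
  calc _ ≤ atTop.liminf fun n =>
        eLpNorm (act (P t) (u n)) (ENNReal.ofReal (hcExponent p C t)) μ :=
        Lp.eLpNorm_lim_le_liminf_eLpNorm
          (fun n => (hP.bdd_act (.of_mem_Icc (hum n) (huM n)) t).measurable.aestronglyMeasurable)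
          _ hlim
    _ ≤ atTop.liminf fun n : ℕ => A * (eLpNorm g (ENNReal.ofReal p) μ
          + ENNReal.ofReal (1 / ((n : ℝ) + 1))) := liminf_le_liminf (Eventually.of_forall hbound)
    _ = _ := hfin.liminf_eq

end IsReversibleMarkovSemigroup

end MixtureHC

end

theorem mainTheorem4 {Ω : Type*} [MeasurableSpace Ω] {ι : Type*} [Fintype ι]
    -- the mixture `π = ∑ₖ wₖ πₖ`
    (w : ι → ℝ) (hw : ∀ k, 0 < w k) (hw1 : ∑ k, w k = 1)
    (πc : ι → Measure Ω) (hπc : ∀ k, IsProbabilityMeasure (πc k))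
    (π : Measure Ω) (hπ : π = ∑ k, ENNReal.ofReal (w k) • πc k)
    -- the reversible semigroup with stationary law `π`, and the component semigroups
    (P : ℝ≥0 → Kernel Ω Ω) (hP : MixtureHC.IsReversibleMarkovSemigroup P π)
    (Pc : ι → ℝ≥0 → Kernel Ω Ω) (hPc : ∀ k, MixtureHC.IsMarkovSemigroup (Pc k) (πc k))
    -- the Dirichlet form dominates the weighted component Dirichlet forms
    (hdec : ∀ f : Ω → ℝ, MemLp f 2 π →
      ∑ k, ENNReal.ofReal (w k) * MixtureHC.dirichletForm (Pc k) (πc k) f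
        ≤ MixtureHC.dirichletForm P π f)
    -- log-Sobolev inequalities for the components
    (c : ι → ℝ) (hc : ∀ k, 0 < c k)
    (hLSI : ∀ k, MixtureHC.LogSobolev (Pc k) (πc k) (c k))
    (Cstar : ℝ) (hCstar : IsGreatest (Set.range c) Cstar)
    (wstar : ℝ) (hwstar : IsLeast (Set.range w) wstar)
    (p : ℝ) (hp : 1 < p)
    (q : ℝ≥0 → ℝ) (hq : q = MixtureHC.hcExponent p Cstar)
    (f : Ω → ℝ) (hf : MemLp f (ENNReal.ofReal p) π) (hfpos : ∀ᵐ x ∂π, 0 < f x) :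
    Antitone (fun t : ℝ≥0 =>
        eLpNorm (MixtureHC.act (P t) f) (ENNReal.ofReal (q t)) π
          / ENNReal.ofReal (wstar ^ (1 / q t))) ∧
      (∀ t : ℝ≥0,
        eLpNorm (MixtureHC.act (P t) f) (ENNReal.ofReal (q t)) π
            / ENNReal.ofReal (wstar ^ (1 / q t))
          ≤ eLpNorm f (ENNReal.ofReal p) π / ENNReal.ofReal (wstar ^ (1 / p))) ∧
      (∀ t : ℝ≥0,
        MemLp (MixtureHC.act (P t) f) (ENNReal.ofReal (q t)) π ∧
        eLpNorm (MixtureHC.act (P t) f) (ENNReal.ofReal (q t)) π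
          ≤ ENNReal.ofReal ((1 / wstar) ^ (1 / p - 1 / q t))
            * eLpNorm f (ENNReal.ofReal p) π) := by

  subst hq
  have hπP : IsProbabilityMeasure π := by
    refine ⟨?_⟩
    rw [hπ]
    simp only [Measure.coe_finsetSum, Finset.sum_apply, Measure.smul_apply, measure_univ,
      smul_eq_mul, mul_one]
    rw [← ENNReal.ofReal_sum_of_nonneg fun k _ => (hw k).le, hw1, ENNReal.ofReal_one]
  obtain ⟨k₀, hk₀⟩ := hwstar.1
  have hw0 : 0 < wstar := hk₀ ▸ hw k₀
  obtain ⟨k₁, hk₁⟩ := hCstar.1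
  have hC0 : 0 < Cstar := hk₁ ▸ hc k₁
  have hLS : MixtureHC.DefectiveLogSobolev P π Cstar (Real.log (1 / wstar)) :=
    MixtureHC.defectiveLogSobolev_mixture hw hπ hdec hLSI
      (fun k => hCstar.2 (Set.mem_range_self k)) hw0 (fun k => hwstar.2 (Set.mem_range_self k))
  have hexp : ∀ s : ℝ, Real.exp (Real.log (1 / wstar) * s) = (1 / wstar) ^ s := fun s =>
    (Real.rpow_def_of_pos (by positivity) s).symm
  have hscale : ∀ {a b : ℝ} {x y : ℝ≥0∞},
      x ≤ ENNReal.ofReal ((1 / wstar) ^ (1 / a - 1 / b)) * y →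
      x / ENNReal.ofReal (wstar ^ (1 / b)) ≤ y / ENNReal.ofReal (wstar ^ (1 / a)) := by
    intro a b x y h
    have ha : 0 < wstar ^ (1 / a) := Real.rpow_pos_of_pos hw0 _
    have hb : 0 < wstar ^ (1 / b) := Real.rpow_pos_of_pos hw0 _
    refine ENNReal.div_le_of_le_mul (h.trans (le_of_eq ?_))
    have e : (1 / wstar) ^ (1 / a - 1 / b) = (wstar ^ (1 / a))⁻¹ * wstar ^ (1 / b) := by
      rw [one_div wstar, Real.inv_rpow hw0.le, Real.rpow_sub hw0, inv_div, div_eq_inv_mul]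
    rw [e, ENNReal.ofReal_mul (by positivity), ENNReal.ofReal_inv_of_pos ha]
    simp only [div_eq_mul_inv]
    ring
  have hf0 : ∀ᵐ x ∂π, 0 ≤ f x := hfpos.mono fun x hx => hx.le
  have hmain : ∀ t : ℝ≥0, eLpNorm (MixtureHC.act (P t) f)
      (ENNReal.ofReal (MixtureHC.hcExponent p Cstar t)) π
      ≤ ENNReal.ofReal ((1 / wstar) ^ (1 / p - 1 / MixtureHC.hcExponent p Cstar t))
        * eLpNorm f (ENNReal.ofReal p) π := by
    intro t
    have := hP.eLpNorm_act_le hp hC0 hLS hf hf0 t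
    rwa [hexp] at this
  have hmem : ∀ t : ℝ≥0, MemLp (MixtureHC.act (P t) f)
      (ENNReal.ofReal (MixtureHC.hcExponent p Cstar t)) π := fun t => by
    have := hP.markov t
    exact ⟨MixtureHC.aestronglyMeasurable_act (hP.invariant t) hf.1,
      (hmain t).trans_lt (ENNReal.mul_lt_top ENNReal.ofReal_lt_top hf.2)⟩
  refine ⟨fun s t hst => ?_, fun t => hscale (hmain t), fun t => ⟨hmem t, hmain t⟩⟩
  have hfi : Integrable f π := hf.integrable (by simpa using hp.le)
  have hae := hP.act_add_ae hfi (t - s) s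
  rw [tsub_add_cancel_of_le hst] at hae
  have h := hP.eLpNorm_act_le (MixtureHC.one_lt_hcExponent hp Cstar s) hC0 hLS (hmem s)
    (MixtureHC.act_nonneg_ae (hP.invariant s) hf0) (t - s)
  rw [← MixtureHC.hcExponent_add, add_tsub_cancel_of_le hst, hexp, ← eLpNorm_congr_ae hae] at h
  exact hscale h
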